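/- Let $(M,\partial M)$ be a compact triangulated $n$-manifold, $n\ge 0$, possibly with (possibly empty) boundary $\partial M$, in the broad sense of mod 2 homology manifolds: $M$ is a finite simplicial complex, $\partial M$ is a subcomplex, and for every $k$-simplex $\sigma$ of $M$ the link of $\sigma$ has the $\mathbb Z/2$-homology of the sphere $S^{n-k-1}$ if $\sigma\notin\partial M$ (with $S^{-1}=\emptyset$), and the $\mathbb Z/2$-homology of a point if $\sigma\in\partial M$. A vertex ordering of $M$ is a partial order on the vertices that is total on the vertices of each simplex. Given a vertex ordering, let $C^k(M,\partial M;\mathbb Z/2)$ and $Z^k(M,\partial M;\mathbb Z/2)$ be the normalized relative simplicial cochains and cocycles (both are $0$ for $k<0$), let $d$ be the coboundary, let $\cup_i$ be Steenrod's cochain products defined with the vertex ordering ($\cup_i=0$ for $i<0$), and let $\int_{[M,\partial M]}w\in\mathbb Z/2$ be the sum of the values of the $n$-cochain $w$ on all $n$-simplices of $M$. A quadratic function on $M$, with the given vertex ordering, is a function $Q\colon Z^{n-1}(M,\partial M;\mathbb Z/2)\to\mathbb R/\mathbb Z$ such that $$Q(p+q)=Q(p)+Q(q)+\tfrac12\int_{[M,\partial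 M]}p\cup_{n-2}q$$ for all $p,q\in Z^{n-1}(M,\partial M;\mathbb Z/2)$, and $$Q(dc)=\tfrac12\int_{[M,\partial M]}Sq^2c=\tfrac12\int_{[M,\partial M]}\bigl(c\cup_{n-4}c+c\cup_{n-3}dc\bigr)$$ for all $c\in C^{n-2}(M,\partial M;\mathbb Z/2)$, where $\tfrac12$ denotes the inclusion $\mathbb Z/2\subset\mathbb R/\mathbb Z$. Let $M'$ be the barycentric subdivision of $M$, whose simplices are the finite nonempty chains of simplices of $M$, with its canonical vertex ordering (by inclusion of simplices, which on each simplex of $M'$ is the ordering by dimension), and let $\partial M'$ be the barycentric subdivision of $\partial M$. Quadratic functions on $M'$ are defined in the same way from the pair $(M',\partial M')$. For a vertex ordering of $M$ let $b\colon(M',\partial M')\to(M,\partial M)$ be the order preserving simplicial map that sends the barycenter of a simplex $\sigma$ of $M$ to the maximum vertex of $\sigma$. 1. For every vertex ordering of $M$, the assignment $$Q'\longmapsto Q'\circ b^*,\qquad Z^{n-1}(M,\partial M;\mathbb Z/2)\xrightarrow{\,b^*\,}Z^{n-1}(M',\partial M';\mathbb Z/2)\xrightarrow{\,Q'\,}\mathbb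 R/\mathbb Z,$$ is a bijection from the set of quadratic functions on $M'$ onto the set of quadratic functions on $M$. 2. Consequently quadratic functions do not depend on the vertex ordering: for any two vertex orderings of $M$, with maps $b_1,b_2\colon M'\to M$, there is exactly one bijection $\Phi$ from the quadratic functions on $M$ for the first ordering to those for the second such that $\Phi(Q'\circ b_1^*)=Q'\circ b_2^*$ for every quadratic function $Q'$ on $M'$. -/

import Mathlib

/-! Cochains, Steenrod cup-`i` products and quadratic functions on ordered simplicial complexes. -/

namespace QuadraticCocycles

universe u v

variable {V : Type u} {W : Type v}

/-! ### Ordered simplicial complexes -/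

/-- A vertex ordering of a simplicial complex: a partial order on the vertices in which the
vertices of each simplex are totally ordered. -/
structure VertexOrder (K : PreAbstractSimplicialComplex V) where
  /-- the partial order -/
  order : PartialOrder V
  total : ∀ s ∈ K.faces, ∀ v ∈ s, ∀ w ∈ s, order.le v w ∨ order.le w v

open scoped Classical in
/-- A (weakly) order preserving simplicial map of pairs `(K, A) → (L, B)`. -/
structure OrderedMap {K : PreAbstractSimplicialComplex V} {L : PreAbstractSimplicialComplex W}
    (oK : VertexOrder K) (A : PreAbstractSimplicialComplex V)
    (oL : VertexOrder L) (B : PreAbstractSimplicialComplex W) where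
  /-- the map on vertices -/
  toFun : V → W
  map_faces : ∀ s ∈ K.faces, s.image toFun ∈ L.faces
  map_sub : ∀ s ∈ A.faces, s.image toFun ∈ B.faces
  mono : ∀ v w, {v} ∈ K.faces → {w} ∈ K.faces →
    oK.order.le v w → oL.order.le (toFun v) (toFun w)

/-! ### Simplicial cochains with `ℤ/2` coefficients

A normalized `k`-cochain of an ordered complex is determined by its values on the nondegenerate
`k`-simplices, i.e. on the faces with `k + 1` vertices. It is stored as a function on all finite
sets of vertices that vanishes away from those faces. Degrees are integers, so that the groups of
negative degree are zero. -/

/-- The relative cochains `C^k(K, A; ℤ/2)`. -/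
def relCochains (K A : PreAbstractSimplicialComplex V) (k : ℤ) :
    Submodule (ZMod 2) (Finset V → ZMod 2) where
  carrier := {c | ∀ s, ¬ (s ∈ K.faces ∧ s ∉ A.faces ∧ (s.card : ℤ) = k + 1) → c s = 0}
  add_mem' := by
    intro a b ha hb s hs
    simp [ha s hs, hb s hs]
  zero_mem' := by
    intro s _
    rfl
  smul_mem' := by
    intro r a ha s hs
    simp [ha s hs]

open scoped Classical in
/-- The simplicial coboundary. -/
noncomputable def coboundary (K : PreAbstractSimplicialComplex V) :
    (Finset V → ZMod 2) →ₗ[ZMod 2] (Finset V → ZMod 2) where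
  toFun c s := if s ∈ K.faces then ∑ v ∈ s, c (s.erase v) else 0
  map_add' a b := by
    funext s
    by_cases hs : s ∈ K.faces <;> simp [hs, Finset.sum_add_distrib]
  map_smul' r a := by
    funext s
    by_cases hs : s ∈ K.faces <;> simp [hs, Finset.mul_sum]

/-- The relative cocycles `Z^k(K, A; ℤ/2)`. -/
noncomputable def relCocycles (K A : PreAbstractSimplicialComplex V) (k : ℤ) :
    Submodule (ZMod 2) (Finset V → ZMod 2) :=
  relCochains K A k ⊓ LinearMap.ker (coboundary K)

/-! ### Steenrod's cup-`i` products

For an ordered simplex `s` and cut vertices `T = {t_0 < t_1 < ⋯ < t_i} ⊆ s`, the first factor is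
evaluated on the closed vertex intervals `[min s, t_0] ∪ [t_1, t_2] ∪ [t_3, t_4] ∪ ⋯` and the
second one on `[t_0, t_1] ∪ [t_2, t_3] ∪ ⋯`. A vertex outside `T` lies in the former
exactly when the number of cut vertices below it is even. -/

open scoped Classical in
/-- The number of cut vertices strictly below `v`. -/
noncomputable def VertexOrder.below {K : PreAbstractSimplicialComplex V} (o : VertexOrder K)
    (T : Finset V) (v : V) : ℕ :=
  (T.filter fun t => o.order.lt t v).card

open scoped Classical in
/-- The vertices of `s` on which the first factor is evaluated. -/
noncomputable def VertexOrder.leftPart {K : PreAbstractSimplicialComplex V} (o : VertexOrder K)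
    (T s : Finset V) : Finset V :=
  s.filter fun v => v ∈ T ∨ Even (o.below T v)

open scoped Classical in
/-- The vertices of `s` on which the second factor is evaluated. -/
noncomputable def VertexOrder.rightPart {K : PreAbstractSimplicialComplex V} (o : VertexOrder K)
    (T s : Finset V) : Finset V :=
  s.filter fun v => v ∈ T ∨ Odd (o.below T v)

open scoped Classical in
/-- Steenrod's product `x ∪_i y`, for cochains of arbitrary degrees `p` and `q`; it has degree
`p + q - i`. Terms with faces of the wrong dimension vanish because `x` and `y` vanish there, and
for negative `i` the product of cochains is zero (for `i = -1` the second factor is evaluated on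
the empty set). -/
noncomputable def cup {K : PreAbstractSimplicialComplex V} (o : VertexOrder K) (i : ℤ)
    (x y : Finset V → ZMod 2) : Finset V → ZMod 2 := fun s =>
  if s ∈ K.faces then
    ∑ T ∈ s.powerset.filter (fun T => (T.card : ℤ) = i + 1),
      x (o.leftPart T s) * y (o.rightPart T s)
  else 0

/-- The cochain operation `Sq^j c = c ∪_{k-j} c + c ∪_{k-j+1} dc` on cochains of degree `k`. -/
noncomputable def sq {K : PreAbstractSimplicialComplex V} (o : VertexOrder K) (j k : ℤ)
    (c : Finset V → ZMod 2) : Finset V → ZMod 2 :=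
  cup o (k - j) c c + cup o (k - j + 1) c (coboundary K c)

/-- The integral over the mod 2 fundamental chain, the sum of all `n`-simplices. -/
noncomputable def integral (K : PreAbstractSimplicialComplex V) (n : ℕ)
    (w : Finset V → ZMod 2) : ZMod 2 :=
  ∑ᶠ s ∈ {s | s ∈ K.faces ∧ s.card = n + 1}, w s

/-- Quadratic functions `Q : Z^{n-1}(K, A; ℤ/2) → ℝ/ℤ`. Here `ZMod.toAddCircle` is the inclusion
`ℤ/2 → ℝ/ℤ`, `1 ↦ 1/2`. -/
structure IsQuadratic {K : PreAbstractSimplicialComplex V} (o : VertexOrder K)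
    (A : PreAbstractSimplicialComplex V) (n : ℕ)
    (Q : relCocycles K A ((n : ℤ) - 1) → UnitAddCircle) : Prop where
  add : ∀ p q, Q (p + q) =
    Q p + Q q + ZMod.toAddCircle (integral K n (cup o ((n : ℤ) - 2) p.1 q.1))
  coboundary : ∀ c ∈ relCochains K A ((n : ℤ) - 2), ∀ p : relCocycles K A ((n : ℤ) - 1),
    p.1 = coboundary K c → Q p = ZMod.toAddCircle (integral K n (sq o 2 ((n : ℤ) - 2) c))

/-! ### Pull-back of cochains -/

open scoped Classical in
/-- The pull-back `f^* c`: a simplex on which `f` is not injective has a degenerate image, where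
normalized cochains vanish. -/
noncomputable def pullback {K : PreAbstractSimplicialComplex V}
    {L : PreAbstractSimplicialComplex W} {oK : VertexOrder K} {A : PreAbstractSimplicialComplex V}
    {oL : VertexOrder L} {B : PreAbstractSimplicialComplex W} (f : OrderedMap oK A oL B)
    (c : Finset W → ZMod 2) : Finset V → ZMod 2 := fun s =>
  if s ∈ K.faces ∧ Set.InjOn f.toFun (s : Set V) then c (s.image f.toFun) else 0

theorem pullback_mem {K : PreAbstractSimplicialComplex V}
    {L : PreAbstractSimplicialComplex W} {oK : VertexOrder K} {A : PreAbstractSimplicialComplex V}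
    {oL : VertexOrder L} {B : PreAbstractSimplicialComplex W} (f : OrderedMap oK A oL B)
    {k : ℤ} {c : Finset W → ZMod 2} (hc : c ∈ relCochains L B k) :
    pullback f c ∈ relCochains K A k := by
  classical
  intro s hs
  unfold pullback
  split_ifs with h
  · apply hc
    rintro ⟨-, h2, h3⟩
    rw [Finset.card_image_of_injOn h.2] at h3
    refine hs ⟨h.1, fun hA => h2 ?_, h3⟩
    convert f.map_sub s hA
  · rfl

theorem pullback_coboundary {K : PreAbstractSimplicialComplex V}
    {L : PreAbstractSimplicialComplex W} {oK : VertexOrder K} {A : PreAbstractSimplicialComplex V}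
    {oL : VertexOrder L} {B : PreAbstractSimplicialComplex W} (f : OrderedMap oK A oL B)
    {k : ℤ} {c : Finset W → ZMod 2} (hc : c ∈ relCochains L B k) :
    coboundary K (pullback f c) = pullback f (coboundary L c) := by
  classical
  have hempty : c ∅ = 0 := hc ∅ fun h => by simpa using (L.isRelLowerSet_faces h.1).1
  funext s
  by_cases hs : s ∈ K.faces
  swap
  · simp [coboundary, pullback, hs]
  have hmem : ∀ v, pullback f c (s.erase v) =
      if Set.InjOn f.toFun ((s.erase v : Finset V) : Set V)
        then c ((s.erase v).image f.toFun) else 0 := by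
    intro v
    unfold pullback
    by_cases hne : (s.erase v).Nonempty
    · have : s.erase v ∈ K.faces := (K.isRelLowerSet_faces hs).2 (Finset.erase_subset v s) hne
      by_cases hi : Set.InjOn f.toFun ((s.erase v : Finset V) : Set V)
      · rw [if_pos ⟨this, hi⟩, if_pos hi]
      · rw [if_neg (fun h => hi h.2), if_neg hi]
    · rw [Finset.not_nonempty_iff_eq_empty] at hne
      simp [hne, hempty]
  have hL : coboundary K (pullback f c) s =
      ∑ v ∈ s, if Set.InjOn f.toFun ((s.erase v : Finset V) : Set V)
        then c ((s.erase v).image f.toFun) else 0 := by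
    simp only [coboundary, LinearMap.coe_mk, AddHom.coe_mk, if_pos hs]
    refine Finset.sum_congr rfl fun v _ => ?_
    rw [← hmem v]
  rw [hL]
  have himg : s.image f.toFun ∈ L.faces := by convert f.map_faces s hs
  by_cases hinj : Set.InjOn f.toFun (s : Set V)
  · have hR : pullback f (coboundary L c) s =
        ∑ w ∈ s.image f.toFun, c ((s.image f.toFun).erase w) := by
      unfold pullback
      rw [if_pos ⟨hs, hinj⟩]
      simp only [coboundary, LinearMap.coe_mk, AddHom.coe_mk]
      rw [if_pos (by convert himg)]
    rw [hR, Finset.sum_image (fun a ha b hb h => hinj ha hb h)]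
    refine Finset.sum_congr rfl fun v hv => ?_
    rw [if_pos (hinj.mono (by simp))]
    congr 1
    ext w
    simp only [Finset.mem_image, Finset.mem_erase]
    constructor
    · rintro ⟨a, ⟨h1, h2⟩, rfl⟩
      exact ⟨fun h => h1 (hinj h2 hv h), a, h2, rfl⟩
    · rintro ⟨h1, a, h2, rfl⟩
      exact ⟨a, ⟨fun h => h1 (by rw [h]), h2⟩, rfl⟩
  · have hR : pullback f (coboundary L c) s = 0 := by
      unfold pullback
      rw [if_neg (fun h => hinj h.2)]
    rw [hR]
    obtain ⟨a, ha, b, hb, hab, hne⟩ : ∃ a ∈ s, ∃ b ∈ s, f.toFun a = f.toFun b ∧ a ≠ b := by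
      simpa [Set.InjOn] using hinj
    have hsub : ∑ v ∈ ({a, b} : Finset V),
        (if Set.InjOn f.toFun ((s.erase v : Finset V) : Set V)
          then c ((s.erase v).image f.toFun) else 0) =
        ∑ v ∈ s, if Set.InjOn f.toFun ((s.erase v : Finset V) : Set V)
          then c ((s.erase v).image f.toFun) else 0 := by
      refine Finset.sum_subset (by intro x; simp; rintro (rfl | rfl) <;> assumption) ?_
      intro x _ hx
      simp only [Finset.mem_insert, Finset.mem_singleton, not_or] at hx
      rw [if_neg]
      intro hi
      exact hne (hi (by simp [ha, Ne.symm hx.1]) (by simp [hb, Ne.symm hx.2]) hab)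
    rw [← hsub, Finset.sum_pair hne]
    have key : ∀ x y, x ∈ s → y ∈ s → f.toFun x = f.toFun y → x ≠ y →
        Set.InjOn f.toFun ((s.erase x : Finset V) : Set V) →
        Set.InjOn f.toFun ((s.erase y : Finset V) : Set V) := by
      intro x y hx hy hxy hxne hi p hp q hq hpq
      simp only [Finset.coe_erase, Set.mem_sdiff, Finset.mem_coe, Set.mem_singleton_iff] at hp hq
      by_cases h1 : p = x <;> by_cases h2 : q = x
      · rw [h1, h2]
      · exact absurd (hi (by simp [hy, hxne.symm]) (by simp [hq.1, h2])
          (by rw [← hxy, ← h1, hpq])) (Ne.symm hq.2)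
      · exact absurd (hi (by simp [hp.1, h1]) (by simp [hy, hxne.symm])
          (by rw [← hxy, ← h2, hpq])) hp.2
      · exact hi (by simp [hp.1, h1]) (by simp [hq.1, h2]) hpq
    have himage : ∀ x y, x ∈ s → y ∈ s → f.toFun x = f.toFun y → x ≠ y →
        (s.erase x).image f.toFun = s.image f.toFun := by
      intro x y hx hy hxy hxne
      apply Finset.Subset.antisymm (Finset.image_subset_image (Finset.erase_subset _ _))
      intro w hw
      obtain ⟨z, hz, rfl⟩ := Finset.mem_image.1 hw
      by_cases hzx : z = x
      · exact Finset.mem_image.2 ⟨y, by simp [hy, hxne.symm], by rw [hzx, hxy]⟩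
      · exact Finset.mem_image.2 ⟨z, by simp [hz, hzx], rfl⟩
    rw [himage a b ha hb hab hne, himage b a hb ha hab.symm hne.symm]
    have hiff := (⟨key a b ha hb hab hne, key b a hb ha hab.symm hne.symm⟩ :
      Set.InjOn f.toFun ((s.erase a : Finset V) : Set V) ↔ _)
    simp only [hiff]
    exact CharTwo.add_self_eq_zero _

/-- The map `f^* : Z^k(L, B; ℤ/2) → Z^k(K, A; ℤ/2)`. -/
noncomputable def pullbackCocycle {K : PreAbstractSimplicialComplex V}
    {L : PreAbstractSimplicialComplex W} {oK : VertexOrder K} {A : PreAbstractSimplicialComplex V}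
    {oL : VertexOrder L} {B : PreAbstractSimplicialComplex W} (f : OrderedMap oK A oL B) (k : ℤ)
    (p : relCocycles L B k) : relCocycles K A k :=
  ⟨pullback f p.1, pullback_mem f p.2.1, by
    have h : coboundary L p.1 = 0 := p.2.2
    change coboundary K (pullback f p.1) = 0
    rw [pullback_coboundary f p.2.1, h]
    funext s
    simp [pullback]⟩

/-! ### Barycentric subdivision -/

/-- The barycentric subdivision of a subcomplex `A` of `K`, as a complex whose vertices are among
the simplices of `K` (standing for their barycenters): its simplices are the nonempty finite
chains, under inclusion, of simplices of `A`. -/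
def sdSub (K A : PreAbstractSimplicialComplex V) :
    PreAbstractSimplicialComplex {s : Finset V // s ∈ K.faces} where
  faces := {F | F.Nonempty ∧ IsChain (· ≤ ·) (F : Set {s : Finset V // s ∈ K.faces}) ∧
    ∀ s ∈ F, s.1 ∈ A.faces}
  isRelLowerSet_faces := by
    rintro F ⟨h1, h2, h3⟩
    exact ⟨h1, fun G hG hne => ⟨hne, h2.mono (by exact_mod_cast hG), fun s hs => h3 s (hG hs)⟩⟩

/-- The barycentric subdivision of `K`. -/
def sd (K : PreAbstractSimplicialComplex V) :
    PreAbstractSimplicialComplex {s : Finset V // s ∈ K.faces} :=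
  sdSub K K

/-- The canonical vertex ordering of the barycentric subdivision, by inclusion of simplices; on
the vertices of a simplex of the subdivision this is the ordering by dimension. -/
def sdOrder (K : PreAbstractSimplicialComplex V) : VertexOrder (sd K) where
  order := inferInstance
  total := by
    rintro F ⟨-, h2, -⟩ s hs t ht
    exact h2.total hs ht

theorem VertexOrder.exists_max {K : PreAbstractSimplicialComplex V} (o : VertexOrder K)
    (s : Finset V) (hs : s ∈ K.faces) : ∃ v ∈ s, ∀ w ∈ s, o.order.le w v := by
  let _ := o.order
  obtain ⟨v, hv⟩ := s.exists_maximal (K.isRelLowerSet_faces hs).1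
  refine ⟨v, hv.1, fun w hw => ?_⟩
  rcases o.total s hs w hw v hv.1 with h | h
  · exact h
  · exact hv.2 hw h

/-- The maximum vertex of a simplex. -/
noncomputable def VertexOrder.maxVertex {K : PreAbstractSimplicialComplex V} (o : VertexOrder K)
    (s : {s : Finset V // s ∈ K.faces}) : V :=
  (o.exists_max s.1 s.2).choose

theorem VertexOrder.maxVertex_mem {K : PreAbstractSimplicialComplex V} (o : VertexOrder K)
    (s : {s : Finset V // s ∈ K.faces}) : o.maxVertex s ∈ s.1 :=
  (o.exists_max s.1 s.2).choose_spec.1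

theorem VertexOrder.le_maxVertex {K : PreAbstractSimplicialComplex V} (o : VertexOrder K)
    (s : {s : Finset V // s ∈ K.faces}) (w : V) (hw : w ∈ s.1) :
    o.order.le w (o.maxVertex s) :=
  (o.exists_max s.1 s.2).choose_spec.2 w hw

open scoped Classical in
theorem VertexOrder.image_maxVertex_mem {K : PreAbstractSimplicialComplex V} (o : VertexOrder K)
    (A : PreAbstractSimplicialComplex V) (F : Finset {s : Finset V // s ∈ K.faces})
    (hF : F ∈ (sdSub K A).faces) : F.image o.maxVertex ∈ A.faces := by
  obtain ⟨h1, h2, h3⟩ := hF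
  obtain ⟨t, ht⟩ := F.exists_maximal h1
  refine (A.isRelLowerSet_faces (h3 t ht.1)).2 ?_ (h1.image _)
  intro v hv
  obtain ⟨s, hs, rfl⟩ := Finset.mem_image.1 hv
  have hst : s ≤ t := by
    rcases h2.total hs ht.1 with h | h
    · exact h
    · exact ht.2 hs h
  exact hst (o.maxVertex_mem s)

/-- The canonical order preserving simplicial map `b : (K', A') → (K, A)` from the barycentric
subdivision, which sends the barycenter of a simplex to the maximum vertex of that simplex. -/
noncomputable def barycentricMap {K : PreAbstractSimplicialComplex V} (o : VertexOrder K)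
    (A : PreAbstractSimplicialComplex V) : OrderedMap (sdOrder K) (sdSub K A) o A where
  toFun := o.maxVertex
  map_faces := o.image_maxVertex_mem K
  map_sub := o.image_maxVertex_mem A
  mono := fun s t _ _ h => o.le_maxVertex t _ (h (o.maxVertex_mem s))

/-! ### Triangulated manifolds -/

open scoped Classical in
/-- The simplicial boundary on `ℤ/2`-chains, with the empty set as a simplex of dimension `-1`. -/
noncomputable def chainBoundary (V : Type u) :
    (Finset V →₀ ZMod 2) →ₗ[ZMod 2] (Finset V →₀ ZMod 2) :=
  Finsupp.lsum (ZMod 2) fun s => LinearMap.toSpanSingleton (ZMod 2) (Finset V →₀ ZMod 2)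
    (∑ v ∈ s, Finsupp.single (s.erase v) 1)

/-- The augmented simplicial chains of degree `k`. -/
noncomputable def augChains (X : PreAbstractSimplicialComplex V) (k : ℤ) :
    Submodule (ZMod 2) (Finset V →₀ ZMod 2) :=
  Finsupp.supported (ZMod 2) (ZMod 2) {s | (s ∈ X.faces ∨ s = ∅) ∧ (s.card : ℤ) = k + 1}

/-- The augmented simplicial cycles of degree `k`. -/
noncomputable def augCycles (X : PreAbstractSimplicialComplex V) (k : ℤ) :
    Submodule (ZMod 2) (Finset V →₀ ZMod 2) :=
  augChains X k ⊓ LinearMap.ker (chainBoundary V)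

/-- The reduced simplicial homology `H̃_k(X; ℤ/2)`. -/
abbrev ReducedHomology (X : PreAbstractSimplicialComplex V) (k : ℤ) : Type u :=
  augCycles X k ⧸
    (((augChains X (k + 1)).map (chainBoundary V)).comap (augCycles X k).subtype :
      Submodule (ZMod 2) (augCycles X k))

/-- `X` has the mod 2 homology of a point. -/
def IsAcyclic (X : PreAbstractSimplicialComplex V) : Prop :=
  ∀ k : ℤ, Subsingleton (ReducedHomology X k)

/-- `X` has the mod 2 homology of a sphere of dimension `d` (the sphere of dimension `-1` is
empty). -/
def IsHomologySphere (X : PreAbstractSimplicialComplex V) (d : ℤ) : Prop :=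
  Nonempty (ReducedHomology X d ≃ₗ[ZMod 2] ZMod 2) ∧
    ∀ k : ℤ, k ≠ d → Subsingleton (ReducedHomology X k)

open scoped Classical in
/-- The link of `s` in `K`. -/
def link (K : PreAbstractSimplicialComplex V) (s : Finset V) : PreAbstractSimplicialComplex V where
  faces := {t | t.Nonempty ∧ Disjoint t s ∧ t ∪ s ∈ K.faces}
  isRelLowerSet_faces := by
    rintro t ⟨h1, h2, h3⟩
    exact ⟨h1, fun r hr hne => ⟨hne, h2.mono_left hr,
      (K.isRelLowerSet_faces h3).2 (Finset.union_subset_union_left hr)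
        (hne.mono Finset.subset_union_left)⟩⟩

/-- `K` is a compact triangulated `n`-manifold with boundary the subcomplex `A`, in the broad sense
of mod 2 homology manifolds: a finite complex in which the link of a `k`-simplex has the mod 2
homology of the `(n - k - 1)`-sphere if the simplex is not in `A`, and that of a point if it is. -/
structure IsTriangulatedManifold (K A : PreAbstractSimplicialComplex V) (n : ℕ) : Prop where
  finite : K.faces.Finite
  sub : A ≤ K
  link_interior : ∀ s ∈ K.faces, s ∉ A.faces →
    IsHomologySphere (link K s) ((n : ℤ) - s.card)
  link_boundary : ∀ s ∈ A.faces, IsAcyclic (link K s)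

end QuadraticCocycles

/-!
Let `f : (K, A) → (L, B)` be an order preserving map that preserves integrals of relative
`n`-cochains, and that induces an isomorphism on relative cohomology in degree `n - 1` and an
epimorphism in degree `n - 2`. A quadratic function `Q` on `L` can only be extended along `f^*` by
`f^* q + dc ↦ Q q + ½ ∫ (Sq² c + f^* q ∪_{n-2} dc)`. The right hand side is additive in `(q, c)` up
to the product term, by Stokes' theorem and Steenrod's formula for `d (x ∪_i y)`. If
`f^* q + dc = 0`, then `q = de` and `c = f^* e + dg`, and the right hand side vanishes. So it
depends only on the cocycle `f^* q + dc`, and `Q' ↦ Q' ∘ f^*` is a bijection.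

For the map `b` from the barycentric subdivision, the subdivision of chains is a right inverse, and
the acyclic carrier of a simplex of the subdivision, the subdivision of its greatest element,
provides the homotopy for the other composition. The subdivision maps the sum of all `n`-simplices
to the sum of all `n`-simplices, so `b` preserves integrals, and Stokes' theorem passes to the
subdivision. It holds on `K` because every `(n - 1)`-simplex outside `A` has an even number of
cofaces: its link has the homology of a `0`-sphere, so an even number of vertices.
-/

namespace QuadraticCocycles

open scoped Classical

variable {V W : Type*}

/-! ### Chains -/

section Chains

/-- The mod 2 chains on the finite subsets of `V`; the empty set is a simplex of dimension `-1`. -/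
abbrev Chains (V : Type*) : Type _ := Finset V →₀ ZMod 2

/-- A simplex as a chain. -/
noncomputable abbrev simplex (s : Finset V) : Chains V := Finsupp.single s 1

/-- The chains supported on a set of simplices. -/
noncomputable abbrev chainsOn (S : Set (Finset V)) : Submodule (ZMod 2) (Chains V) :=
  Finsupp.supported (ZMod 2) (ZMod 2) S

theorem simplex_mem_chainsOn {S : Set (Finset V)} {s : Finset V} (hs : s ∈ S) :
    simplex s ∈ chainsOn S :=
  Finsupp.single_mem_supported _ _ hs

theorem chainsOn_le {S : Set (Finset V)} {N : Submodule (ZMod 2) (Chains V)}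
    (h : ∀ s ∈ S, simplex s ∈ N) : chainsOn S ≤ N := by
  rw [chainsOn, Finsupp.supported_eq_span_single, Submodule.span_le]
  rintro _ ⟨s, hs, rfl⟩
  exact h s hs

theorem chains_hom_ext {M : Type*} [AddCommGroup M] [Module (ZMod 2) M]
    {f g : Chains V →ₗ[ZMod 2] M} (h : ∀ s, f (simplex s) = g (simplex s)) : f = g :=
  Finsupp.lhom_ext' fun s => LinearMap.ext_ring (h s)

theorem chainBoundary_simplex (s : Finset V) :
    chainBoundary V (simplex s) = ∑ v ∈ s, simplex (s.erase v) := by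
  simp [chainBoundary]

theorem chainBoundary_simplex_empty : chainBoundary V (simplex ∅) = 0 := by
  rw [chainBoundary_simplex, Finset.sum_empty]

theorem chainBoundary_simplex_apply (s r : Finset V) :
    chainBoundary V (simplex s) r = if r ⋖ s then 1 else 0 := by
  simp only [chainBoundary_simplex, Finsupp.finsetSum_apply, Finsupp.single_apply]
  split_ifs with h
  · obtain ⟨v, hv, rfl⟩ := h.exists_finset_erase
    rw [Finset.sum_eq_single_of_mem v hv fun w hw hwv => if_neg fun h => ?_, if_pos rfl]
    exact hwv (Finset.erase_injOn s hw hv h)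
  · refine Finset.sum_eq_zero fun v hv => if_neg ?_
    rintro rfl
    exact h (Finset.erase_covBy hv)

theorem chainBoundary_simplex_mem {S : Set (Finset V)} (hS : IsLowerSet S) {s : Finset V}
    (hs : s ∈ S) : chainBoundary V (simplex s) ∈ chainsOn S := by
  rw [chainBoundary_simplex]
  exact Submodule.sum_mem _ fun v _ => simplex_mem_chainsOn (hS (Finset.erase_subset v s) hs)

theorem chainsOn_le_of_chainBoundary {S : Set (Finset V)} (hS : IsLowerSet S)
    {N : Submodule (ZMod 2) (Chains V)}
    (h : ∀ s ∈ S, chainBoundary V (simplex s) ∈ N → simplex s ∈ N) : chainsOn S ≤ N := by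
  refine chainsOn_le fun s => ?_
  induction s using Finset.strongInduction with
  | H s ih =>
    refine fun hs => h s hs ?_
    rw [chainBoundary_simplex]
    exact Submodule.sum_mem _ fun v hv =>
      ih _ (Finset.erase_ssubset hv) (hS (Finset.erase_subset v s) hs)

theorem isLowerSet_insert_empty_faces (K : PreAbstractSimplicialComplex V) :
    IsLowerSet (insert ∅ K.faces) := by
  rintro s t hts (rfl | hs)
  · exact Or.inl (Finset.subset_empty.1 hts)
  · exact t.eq_empty_or_nonempty.imp id ((K.isRelLowerSet_faces hs).2 hts)

/-- The cone with apex `v` on a chain. -/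
noncomputable def cone (v : V) : Chains V →ₗ[ZMod 2] Chains V :=
  Finsupp.linearCombination (ZMod 2) fun s => if v ∈ s then 0 else simplex (insert v s)

theorem cone_simplex_of_mem {v : V} {s : Finset V} (hv : v ∈ s) : cone v (simplex s) = 0 := by
  simp [cone, hv]

theorem cone_simplex_of_notMem {v : V} {s : Finset V} (hv : v ∉ s) :
    cone v (simplex s) = simplex (insert v s) := by
  simp [cone, hv]

theorem cone_simplex_erase {v : V} {s : Finset V} (hv : v ∈ s) :
    cone v (simplex (s.erase v)) = simplex s := by
  rw [cone_simplex_of_notMem (Finset.notMem_erase v s), Finset.insert_erase hv]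

theorem chainBoundary_cone (v : V) (x : Chains V) :
    chainBoundary V (cone v x) = x + cone v (chainBoundary V x) := by
  suffices h : chainBoundary V ∘ₗ cone v = LinearMap.id + cone v ∘ₗ chainBoundary V from
    LinearMap.congr_fun h x
  refine chains_hom_ext fun s => ?_
  simp only [LinearMap.comp_apply, LinearMap.add_apply, LinearMap.id_apply, chainBoundary_simplex,
    map_sum]
  by_cases hv : v ∈ s
  · rw [cone_simplex_of_mem hv, map_zero, ← Finset.add_sum_erase s _ hv, cone_simplex_erase hv,
      Finset.sum_eq_zero, add_zero, ZModModule.add_self]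
    intro w hw
    exact cone_simplex_of_mem (Finset.mem_erase.2 ⟨(Finset.ne_of_mem_erase hw).symm, hv⟩)
  · rw [cone_simplex_of_notMem hv, chainBoundary_simplex, Finset.sum_insert hv,
      Finset.erase_insert hv]
    congr 1
    refine Finset.sum_congr rfl fun w hw => ?_
    have hvw : v ≠ w := fun h => hv (h ▸ hw)
    rw [cone_simplex_of_notMem (fun h => hv (Finset.mem_of_mem_erase h)),
      Finset.erase_insert_of_ne hvw]

theorem cone_chainBoundary_simplex {v : V} {s : Finset V} (hv : v ∈ s) :
    cone v (chainBoundary V (simplex s)) = simplex s := by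
  have h := chainBoundary_cone v (simplex s)
  rw [cone_simplex_of_mem hv, map_zero, ← ZModModule.sub_eq_add] at h
  exact (sub_eq_zero.1 h.symm).symm

theorem chainBoundary_chainBoundary (x : Chains V) :
    chainBoundary V (chainBoundary V x) = 0 := by
  suffices h : chainBoundary V ∘ₗ chainBoundary V = 0 from LinearMap.congr_fun h x
  refine chains_hom_ext fun s => ?_
  simp only [LinearMap.comp_apply, LinearMap.zero_apply]
  induction s using Finset.induction_on with
  | empty => rw [chainBoundary_simplex_empty, map_zero]
  | insert v s hv ih =>
    rw [← cone_simplex_of_notMem hv, chainBoundary_cone, map_add, chainBoundary_cone, ih, map_zero,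
      add_zero, ZModModule.add_self]

theorem cone_apply [inst : DecidableEq V] (v : V) (x : Chains V) (s : Finset V) :
    cone v x s = if v ∈ s then x (s.erase v) else 0 := by
  obtain rfl : inst = fun a b => Classical.propDecidable (a = b) := Subsingleton.elim _ _
  suffices h : Finsupp.lapply s ∘ₗ cone v =
      if v ∈ s then Finsupp.lapply (s.erase v) else (0 : Chains V →ₗ[ZMod 2] ZMod 2) by
    have hx := LinearMap.congr_fun h x
    split_ifs at hx ⊢ <;> exact hx
  refine chains_hom_ext fun t => ?_
  rw [LinearMap.comp_apply, Finsupp.lapply_apply]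
  by_cases ht : v ∈ t
  · rw [cone_simplex_of_mem ht]
    split_ifs
    · refine (Finsupp.single_eq_of_ne ?_).symm
      rintro rfl
      exact Finset.notMem_erase v s ht
    · rfl
  · rw [cone_simplex_of_notMem ht]
    split_ifs with hs
    · rw [Finsupp.lapply_apply, Finsupp.single_apply, Finsupp.single_apply]
      congr 1
      rw [eq_comm (a := t), Finset.erase_eq_iff_eq_insert hs ht, eq_comm (a := s)]
    · exact Finsupp.single_eq_of_ne fun h => hs (h ▸ Finset.mem_insert_self v t)

/-- The map on normalized chains induced by a map of vertices: simplices with a degenerate image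
are sent to zero. -/
noncomputable def pushforward (f : V → W) : Chains V →ₗ[ZMod 2] Chains W :=
  Finsupp.linearCombination (ZMod 2) fun s =>
    if Set.InjOn f (s : Set V) then simplex (s.image f) else 0

theorem pushforward_simplex (f : V → W) (s : Finset V) : pushforward f (simplex s) =
    if Set.InjOn f (s : Set V) then simplex (s.image f) else 0 := by
  simp [pushforward]

theorem pushforward_simplex_empty (f : V → W) : pushforward f (simplex ∅) = simplex ∅ := by
  simp [pushforward_simplex]

theorem pushforward_cone (f : V → W) (v : V) (x : Chains V) :
    pushforward f (cone v x) = cone (f v) (pushforward f x) := by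
  suffices h : pushforward f ∘ₗ cone v = cone (f v) ∘ₗ pushforward f from LinearMap.congr_fun h x
  refine chains_hom_ext fun s => ?_
  simp only [LinearMap.comp_apply, pushforward_simplex]
  by_cases hv : v ∈ s
  · rw [cone_simplex_of_mem hv, map_zero]
    split_ifs
    · rw [cone_simplex_of_mem (Finset.mem_image_of_mem f hv)]
    · rw [map_zero]
  · have hinj : Set.InjOn f ((insert v s : Finset V) : Set V) ↔
        Set.InjOn f (s : Set V) ∧ f v ∉ s.image f := by
      rw [Finset.coe_insert, Set.injOn_insert (by simpa using hv), ← Finset.coe_image,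
        Finset.mem_coe]
    rw [cone_simplex_of_notMem hv, pushforward_simplex, Finset.image_insert]
    by_cases hs : Set.InjOn f (s : Set V)
    · by_cases hfv : f v ∈ s.image f
      · rw [if_neg (fun h => (hinj.1 h).2 hfv), if_pos hs, cone_simplex_of_mem hfv]
      · rw [if_pos (hinj.2 ⟨hs, hfv⟩), if_pos hs, cone_simplex_of_notMem hfv]
    · rw [if_neg hs, if_neg (fun h => hs (hinj.1 h).1), map_zero]

theorem pushforward_chainBoundary (f : V → W) (x : Chains V) :
    pushforward f (chainBoundary V x) = chainBoundary W (pushforward f x) := by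
  suffices h : pushforward f ∘ₗ chainBoundary V = chainBoundary W ∘ₗ pushforward f from
    LinearMap.congr_fun h x
  refine chains_hom_ext fun s => ?_
  simp only [LinearMap.comp_apply]
  induction s using Finset.induction_on with
  | empty =>
    rw [pushforward_simplex_empty, chainBoundary_simplex_empty, chainBoundary_simplex_empty,
      map_zero]
  | insert v s hv ih =>
    rw [← cone_simplex_of_notMem hv, chainBoundary_cone, map_add, pushforward_cone,
      pushforward_cone, chainBoundary_cone, ih]

end Chains

/-! ### Acyclic carriers -/

section Recursion

variable {P Q : Type*}

/-- The values on simplices of `boundaryRec`. -/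
noncomputable def boundaryRecSimplex (g : Finset Q → Chains P)
    (C : Finset Q → Chains P →ₗ[ZMod 2] Chains P) : Finset Q → Chains P
  | s => g s + C s (∑ v ∈ s.attach, boundaryRecSimplex g C (s.erase v))
termination_by s => s.card
decreasing_by exact Finset.card_erase_lt_of_mem v.2

/-- The linear map `R` determined by the recursion `R s = g s + C s (R (∂ s))` over simplices.
Acyclic carrier constructions are of this form, with `C s` a cone operator. -/
noncomputable def boundaryRec (g : Finset Q → Chains P)
    (C : Finset Q → Chains P →ₗ[ZMod 2] Chains P) : Chains Q →ₗ[ZMod 2] Chains P :=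
  Finsupp.linearCombination (ZMod 2) (boundaryRecSimplex g C)

theorem boundaryRec_simplex (g : Finset Q → Chains P)
    (C : Finset Q → Chains P →ₗ[ZMod 2] Chains P) (s : Finset Q) :
    boundaryRec g C (simplex s) = g s + C s (boundaryRec g C (chainBoundary Q (simplex s))) := by
  simp only [boundaryRec, chainBoundary_simplex, map_sum, Finsupp.linearCombination_single,
    one_smul]
  rw [boundaryRecSimplex, Finset.sum_attach s fun v => boundaryRecSimplex g C (s.erase v), map_sum]

end Recursion

section ConeHomotopy

variable {P : Type*} [PartialOrder P]

/-- The cone with apex the greatest element of `F`; it is zero if there is none. -/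
noncomputable def topCone (F : Finset P) : Chains P →ₗ[ZMod 2] Chains P :=
  if h : ∃ t, IsGreatest (F : Set P) t then cone h.choose else 0

theorem topCone_eq_cone {F : Finset P} {t : P} (ht : IsGreatest (F : Set P) t) :
    topCone F = cone t := by
  have h : ∃ t, IsGreatest (F : Set P) t := ⟨t, ht⟩
  rw [topCone, dif_pos h, h.choose_spec.unique ht]

/-- The acyclic carrier homotopy between the identity and a chain map `φ`; it sends a simplex `F`
to a cone with apex the greatest element of `F`. -/
noncomputable def coneHomotopy (φ : Chains P →ₗ[ZMod 2] Chains P) :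
    Chains P →ₗ[ZMod 2] Chains P :=
  boundaryRec (fun F => topCone F (simplex F + φ (simplex F))) topCone

theorem coneHomotopy_simplex (φ : Chains P →ₗ[ZMod 2] Chains P) (F : Finset P) :
    coneHomotopy φ (simplex F) = topCone F
      (simplex F + φ (simplex F) + coneHomotopy φ (chainBoundary P (simplex F))) := by
  rw [coneHomotopy, boundaryRec_simplex, map_add _ (_ + _)]

theorem coneHomotopy_simplex_empty (φ : Chains P →ₗ[ZMod 2] Chains P) :
    coneHomotopy φ (simplex ∅) = 0 := by
  rw [coneHomotopy_simplex, topCone, dif_neg, LinearMap.zero_apply]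
  rintro ⟨t, ht, -⟩
  exact Finset.notMem_empty t ht

theorem exists_isGreatest_of_isChain {F : Finset P} (hF : IsChain (· ≤ ·) (F : Set P))
    (hne : F.Nonempty) : ∃ t, IsGreatest (F : Set P) t := by
  obtain ⟨t, ht⟩ := F.exists_maximal hne
  exact ⟨t, ht.1, fun s hs => (hF.total hs ht.1).elim id (ht.2 hs)⟩

theorem isLowerSet_isChain : IsLowerSet {F : Finset P | IsChain (· ≤ ·) (F : Set P)} :=
  fun _ _ hGF hF => hF.mono (Finset.coe_subset.2 hGF)

theorem chainBoundary_coneHomotopy {φ : Chains P →ₗ[ZMod 2] Chains P}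
    (hempty : φ (simplex ∅) = simplex ∅)
    (hφ : ∀ F : Finset P, IsChain (· ≤ ·) (F : Set P) →
      chainBoundary P (φ (simplex F)) = φ (chainBoundary P (simplex F)))
    {x : Chains P} (hx : x ∈ chainsOn {F | IsChain (· ≤ ·) (F : Set P)}) :
    chainBoundary P (coneHomotopy φ x) + coneHomotopy φ (chainBoundary P x) = x + φ x := by
  suffices h : chainsOn {F | IsChain (· ≤ ·) (F : Set P)} ≤ LinearMap.eqLocus
      (chainBoundary P ∘ₗ coneHomotopy φ + coneHomotopy φ ∘ₗ chainBoundary P)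
      (LinearMap.id + φ) from h hx
  refine chainsOn_le_of_chainBoundary isLowerSet_isChain fun F hF hboundary => ?_
  simp only [LinearMap.mem_eqLocus, LinearMap.add_apply, LinearMap.comp_apply, LinearMap.id_apply,
    chainBoundary_chainBoundary, map_zero, add_zero] at hboundary ⊢
  obtain rfl | hne := F.eq_empty_or_nonempty
  · simp only [coneHomotopy_simplex_empty, chainBoundary_simplex_empty, hempty, map_zero,
      ZModModule.add_self]
  obtain ⟨t, ht⟩ := exists_isGreatest_of_isChain hF hne
  have hcycle : chainBoundary P (simplex F + φ (simplex F) +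
      coneHomotopy φ (chainBoundary P (simplex F))) = 0 := by
    rw [map_add, map_add, hφ F hF, hboundary, ZModModule.add_self]
  rw [coneHomotopy_simplex, topCone_eq_cone ht, chainBoundary_cone, hcycle, map_zero, add_zero,
    add_assoc, ZModModule.add_self, add_zero]

/-- The chains of the partial order with `k` elements, all of them in `S`. -/
def flags (S : Set P) (k : ℕ) : Set (Finset P) :=
  {G | IsChain (· ≤ ·) (G : Set P) ∧ G.card = k ∧ (G : Set P) ⊆ S}

theorem flags_mono {S T : Set P} (h : S ⊆ T) (k : ℕ) : flags S k ⊆ flags T k :=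
  fun _ hG => ⟨hG.1, hG.2.1, hG.2.2.trans h⟩

theorem cone_mem_flags {S : Set P} {t : P} (ht : IsGreatest S t) {k : ℕ} {x : Chains P}
    (hx : x ∈ chainsOn (flags S k)) : cone t x ∈ chainsOn (flags S (k + 1)) := by
  suffices h : chainsOn (flags S k) ≤ (chainsOn (flags S (k + 1))).comap (cone t) from h hx
  refine chainsOn_le fun G hG => ?_
  rw [Submodule.mem_comap]
  by_cases htG : t ∈ G
  · rw [cone_simplex_of_mem htG]
    exact Submodule.zero_mem _
  · rw [cone_simplex_of_notMem htG]
    refine simplex_mem_chainsOn ⟨?_, ?_, ?_⟩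
    · rw [Finset.coe_insert]
      exact hG.1.insert fun g hg _ => Or.inr (ht.2 (hG.2.2 hg))
    · rw [Finset.card_insert_of_notMem htG, hG.2.1]
    · rw [Finset.coe_insert]
      exact Set.insert_subset ht.1 hG.2.2

theorem coneHomotopy_mem_flags {φ : Chains P →ₗ[ZMod 2] Chains P}
    (hφ : ∀ F : Finset P, IsChain (· ≤ ·) (F : Set P) →
      φ (simplex F) ∈ chainsOn (flags (lowerClosure (F : Set P)) F.card))
    (F : Finset P) (hF : IsChain (· ≤ ·) (F : Set P)) :
    coneHomotopy φ (simplex F) ∈ chainsOn (flags (lowerClosure (F : Set P)) (F.card + 1)) := by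
  induction F using Finset.strongInduction with
  | H F ih =>
    obtain rfl | hne := F.eq_empty_or_nonempty
    · rw [coneHomotopy_simplex_empty]
      exact Submodule.zero_mem _
    obtain ⟨t, ht⟩ := exists_isGreatest_of_isChain hF hne
    have hclosure : IsGreatest (lowerClosure (F : Set P) : Set P) t :=
      ⟨subset_lowerClosure ht.1, fun s ⟨r, hr, hsr⟩ => hsr.trans (ht.2 hr)⟩
    rw [coneHomotopy_simplex, topCone_eq_cone ht, chainBoundary_simplex, map_sum]
    refine cone_mem_flags hclosure (Submodule.add_mem _ (Submodule.add_mem _ ?_ (hφ F hF))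
      (Submodule.sum_mem _ fun v hv => ?_))
    · exact simplex_mem_chainsOn ⟨hF, rfl, subset_lowerClosure⟩
    · have hsub : (F.erase v : Set P) ⊆ F := Finset.coe_subset.2 (Finset.erase_subset v F)
      have h := ih _ (Finset.erase_ssubset hv) (hF.mono hsub)
      rw [Finset.card_erase_add_one hv] at h
      exact Finsupp.supported_mono (flags_mono (lowerClosure_mono hsub) _) h

end ConeHomotopy

/-! ### Subdivision of chains -/

section Subdivision

variable {K A : PreAbstractSimplicialComplex V}

theorem empty_notMem_faces (K : PreAbstractSimplicialComplex V) : ∅ ∉ K.faces :=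
  fun h => Finset.not_nonempty_empty (K.isRelLowerSet_faces h).1

/-- Barycentric subdivision of chains. -/
noncomputable def sdChain (K : PreAbstractSimplicialComplex V) :
    Chains V →ₗ[ZMod 2] Chains {s : Finset V // s ∈ K.faces} :=
  boundaryRec (fun s => if s = ∅ then simplex ∅ else 0)
    fun s => if h : s ∈ K.faces then cone ⟨s, h⟩ else 0

theorem sdChain_simplex_empty : sdChain K (simplex ∅) = simplex ∅ := by
  rw [sdChain, boundaryRec_simplex, if_pos rfl, dif_neg (empty_notMem_faces K),
    LinearMap.zero_apply, add_zero]

theorem sdChain_simplex {s : Finset V} (hs : s ∈ K.faces) :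
    sdChain K (simplex s) = cone ⟨s, hs⟩ (sdChain K (chainBoundary V (simplex s))) := by
  rw [sdChain, boundaryRec_simplex, if_neg (K.isRelLowerSet_faces hs).1.ne_empty, dif_pos hs,
    zero_add]

theorem chainBoundary_sdChain {x : Chains V} (hx : x ∈ chainsOn (insert ∅ K.faces)) :
    chainBoundary _ (sdChain K x) = sdChain K (chainBoundary V x) := by
  suffices h : chainsOn (insert ∅ K.faces) ≤
      LinearMap.eqLocus (chainBoundary _ ∘ₗ sdChain K) (sdChain K ∘ₗ chainBoundary V) from h hx
  refine chainsOn_le_of_chainBoundary (isLowerSet_insert_empty_faces K) ?_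
  simp only [LinearMap.mem_eqLocus, LinearMap.comp_apply, chainBoundary_chainBoundary, map_zero]
  rintro s (rfl | hs) hboundary
  · rw [sdChain_simplex_empty, chainBoundary_simplex_empty, chainBoundary_simplex_empty, map_zero]
  · rw [sdChain_simplex hs, chainBoundary_cone, hboundary, map_zero, add_zero]

theorem pushforward_sdChain (o : VertexOrder K) {x : Chains V}
    (hx : x ∈ chainsOn (insert ∅ K.faces)) : pushforward o.maxVertex (sdChain K x) = x := by
  suffices h : chainsOn (insert ∅ K.faces) ≤
      LinearMap.eqLocus (pushforward o.maxVertex ∘ₗ sdChain K) LinearMap.id from h hx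
  refine chainsOn_le_of_chainBoundary (isLowerSet_insert_empty_faces K) ?_
  simp only [LinearMap.mem_eqLocus, LinearMap.comp_apply, LinearMap.id_apply]
  rintro s (rfl | hs) hboundary
  · rw [sdChain_simplex_empty, pushforward_simplex_empty]
  · rw [sdChain_simplex hs, pushforward_cone, hboundary,
      cone_chainBoundary_simplex (o.maxVertex_mem ⟨s, hs⟩)]

theorem sdChain_simplex_mem_flags {s : Finset V} (hs : s ∈ (insert ∅ K.faces : Set (Finset V))) :
    sdChain K (simplex s) ∈ chainsOn (flags {g | g.1 ⊆ s} s.card) := by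
  induction s using Finset.strongInduction with
  | H s ih =>
    obtain rfl | hs' := hs
    · rw [sdChain_simplex_empty]
      exact simplex_mem_chainsOn
        ⟨by simp only [Finset.coe_empty, IsChain.empty], rfl, by simp only [Finset.coe_empty,
          Set.empty_subset]⟩
    · obtain ⟨k, hk⟩ := Nat.exists_eq_add_one.2 (K.isRelLowerSet_faces hs').1.card_pos
      rw [sdChain_simplex hs', chainBoundary_simplex, map_sum, hk]
      refine cone_mem_flags ⟨Finset.Subset.refl s, fun g hg => hg⟩
        (Submodule.sum_mem _ fun v hv => ?_)
      have h := ih _ (Finset.erase_ssubset hv)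
        (isLowerSet_insert_empty_faces K (Finset.erase_subset v s) (Or.inr hs'))
      rw [Finset.card_erase_of_mem hv, hk, Nat.add_sub_cancel] at h
      exact Finsupp.supported_mono
        (flags_mono (fun g hg => hg.trans (Finset.erase_subset v s)) k) h

theorem sdChain_simplex_apply_eq_zero {s : Finset V}
    (hs : s ∈ (insert ∅ K.faces : Set (Finset V))) {F : Finset {s : Finset V // s ∈ K.faces}}
    (hF : ¬ ∀ g ∈ F, g.1 ⊆ s) : sdChain K (simplex s) F = 0 := by
  by_contra h
  exact hF ((Finsupp.mem_supported _ _).1 (sdChain_simplex_mem_flags hs)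
    (Finset.mem_coe.2 (Finsupp.mem_support_iff.2 h))).2.2

theorem card_le_card_of_isChain {F : Finset {s : Finset V // s ∈ K.faces}}
    (hF : IsChain (· ≤ ·) (F : Set {s : Finset V // s ∈ K.faces})) {t : Finset V}
    (ht : ∀ g ∈ F, g.1 ⊆ t) : F.card ≤ t.card := by
  have h : F.card ≤ (Finset.Icc 1 t.card).card := by
    refine Finset.card_le_card_of_injOn (fun g => g.1.card) (fun g hg => ?_) ?_
    · exact Finset.mem_coe.2 (Finset.mem_Icc.2
        ⟨(K.isRelLowerSet_faces g.2).1.card_pos, Finset.card_le_card (ht g hg)⟩)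
    · intro g hg g' hg' h
      rcases hF.total hg hg' with h' | h'
      · exact Subtype.ext (Finset.eq_of_subset_of_card_le h' h.ge)
      · exact Subtype.ext (Finset.eq_of_subset_of_card_le h' h.le).symm
  rwa [Nat.card_Icc, Nat.add_sub_cancel] at h

theorem exists_erase_of_isChain {F : Finset {s : Finset V // s ∈ K.faces}}
    (hF : IsChain (· ≤ ·) (F : Set {s : Finset V // s ∈ K.faces})) {s : Finset V}
    (hs : ∀ g ∈ F, g.1 ⊂ s) (hcard : F.card + 1 = s.card) :
    ∃ w ∈ s, ∀ v ∈ s, (∀ g ∈ F, g.1 ⊆ s.erase v) ↔ v = w := by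
  obtain ⟨t, hts, ht⟩ : ∃ t ⊂ s, ∀ r, (∀ g ∈ F, g.1 ⊆ r) ↔ t ⊆ r := by
    obtain rfl | hne := F.eq_empty_or_nonempty
    · refine ⟨∅, Finset.empty_ssubset.2 (Finset.card_pos.1 (by omega)), fun r => ?_⟩
      simp only [Finset.notMem_empty, false_imp_iff, implies_true, Finset.empty_subset]
    · obtain ⟨t, htF, htop⟩ := exists_isGreatest_of_isChain hF hne
      exact ⟨t.1, hs t htF, fun r => ⟨fun h => h t htF, fun h g hg =>
        Finset.Subset.trans (htop hg) h⟩⟩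
  have hle : F.card ≤ t.card := card_le_card_of_isChain hF ((ht t).2 (Finset.Subset.refl t))
  have hlt : t.card < s.card := Finset.card_lt_card hts
  have hcov : t ⋖ s := Finset.covBy_iff_card_sdiff_eq_one.2
    ⟨hts.subset, by rw [Finset.card_sdiff_of_subset hts.subset]; omega⟩
  obtain ⟨w, hw, rfl⟩ := hcov.exists_finset_erase
  refine ⟨w, hw, fun v hv => ?_⟩
  rw [ht, Finset.subset_erase, Finset.mem_erase, not_and, not_imp_not]
  exact ⟨fun h => h.2 hv, fun h => ⟨Finset.erase_subset w s, fun _ => h⟩⟩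

theorem sdChain_simplex_apply {s : Finset V} (hs : s ∈ (insert ∅ K.faces : Set (Finset V)))
    {F : Finset {s : Finset V // s ∈ K.faces}}
    (hF : IsChain (· ≤ ·) (F : Set {s : Finset V // s ∈ K.faces})) (hcard : F.card = s.card) :
    sdChain K (simplex s) F = if ∀ g ∈ F, g.1 ⊆ s then 1 else 0 := by
  split_ifs with hsub
  swap
  · exact sdChain_simplex_apply_eq_zero hs hsub
  induction s using Finset.strongInduction generalizing F with
  | H s ih =>
    obtain rfl | hs' := hs
    · obtain rfl := Finset.card_eq_zero.1 hcard
      rw [sdChain_simplex_empty, Finsupp.single_eq_same]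
    obtain ⟨t, ht, htop⟩ := exists_isGreatest_of_isChain hF
      (Finset.card_pos.1 (hcard ▸ (K.isRelLowerSet_faces hs').1.card_pos))
    obtain rfl : t = ⟨s, hs'⟩ := Subtype.ext (Finset.eq_of_subset_of_card_le (hsub t ht)
      (hcard ▸ card_le_card_of_isChain hF fun g hg => htop hg))
    have hchain : IsChain (· ≤ ·)
        ((F.erase ⟨s, hs'⟩ : Finset _) : Set {s : Finset V // s ∈ K.faces}) :=
      hF.mono (Finset.coe_subset.2 (Finset.erase_subset _ F))
    have hcard' : (F.erase ⟨s, hs'⟩).card + 1 = s.card :=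
      (Finset.card_erase_add_one ht).trans hcard
    obtain ⟨w, hw, hw'⟩ := exists_erase_of_isChain hchain
      (fun g hg => ssubset_of_subset_of_ne (hsub g (Finset.mem_of_mem_erase hg)) fun h =>
        Finset.ne_of_mem_erase hg (Subtype.ext h)) hcard'
    have herase : ∀ v, s.erase v ∈ (insert ∅ K.faces : Set (Finset V)) := fun v =>
      isLowerSet_insert_empty_faces K (Finset.erase_subset v s) (Or.inr hs')
    rw [sdChain_simplex hs', cone_apply, if_pos (Finset.mem_coe.1 ht), chainBoundary_simplex,
      map_sum, Finsupp.finsetSum_apply, Finset.sum_eq_single_of_mem w hw]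
    · refine ih _ (Finset.erase_ssubset hw) (herase w) hchain ?_ ((hw' w hw).2 rfl)
      have := Finset.card_erase_add_one hw
      omega
    · exact fun v hv hvw =>
        sdChain_simplex_apply_eq_zero (herase v) fun h => hvw ((hw' v hv).1 h)

end Subdivision

/-! ### Cochain maps dual to chain maps -/

section DualMaps

/-- The value of a cochain on a chain. -/
noncomputable abbrev evalChain : (Finset V → ZMod 2) →ₗ[ZMod 2] Chains V →ₗ[ZMod 2] ZMod 2 :=
  Finsupp.bilinearCombination (ZMod 2) (ZMod 2)

theorem evalChain_simplex (c : Finset V → ZMod 2) (s : Finset V) :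
    evalChain c (simplex s) = c s := by
  simp

theorem evalChain_eq_zero {S : Set (Finset V)} {c : Finset V → ZMod 2} (hc : ∀ s ∈ S, c s = 0)
    {x : Chains V} (hx : x ∈ chainsOn S) : evalChain c x = 0 :=
  chainsOn_le (N := LinearMap.ker (evalChain c))
    (fun s hs => (evalChain_simplex c s).trans (hc s hs)) hx

/-- The map on cochains dual to a map `φ` on chains, with values extended by zero away from the
faces of `K`. -/
noncomputable def dualMap (K : PreAbstractSimplicialComplex V)
    (φ : Chains V →ₗ[ZMod 2] Chains W) : (Finset W → ZMod 2) →ₗ[ZMod 2] (Finset V → ZMod 2) :=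
  LinearMap.pi fun s => if s ∈ K.faces then LinearMap.flip evalChain (φ (simplex s)) else 0

variable {K A : PreAbstractSimplicialComplex V} {L B : PreAbstractSimplicialComplex W}

theorem dualMap_apply {s : Finset V} (hs : s ∈ K.faces) (φ : Chains V →ₗ[ZMod 2] Chains W)
    (c : Finset W → ZMod 2) : dualMap K φ c s = evalChain c (φ (simplex s)) := by
  rw [dualMap, LinearMap.pi_apply, if_pos hs, LinearMap.flip_apply]

theorem dualMap_apply_of_notMem {s : Finset V} (hs : s ∉ K.faces)
    (φ : Chains V →ₗ[ZMod 2] Chains W) (c : Finset W → ZMod 2) : dualMap K φ c s = 0 := by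
  rw [dualMap, LinearMap.pi_apply, if_neg hs, LinearMap.zero_apply]

theorem dualMap_congr {φ ψ : Chains V →ₗ[ZMod 2] Chains W}
    (h : ∀ s ∈ K.faces, φ (simplex s) = ψ (simplex s)) : dualMap K φ = dualMap K ψ := by
  refine LinearMap.ext fun c => funext fun s => ?_
  by_cases hs : s ∈ K.faces
  · rw [dualMap_apply hs, dualMap_apply hs, h s hs]
  · rw [dualMap_apply_of_notMem hs, dualMap_apply_of_notMem hs]

theorem dualMap_add (φ ψ : Chains V →ₗ[ZMod 2] Chains W) :
    dualMap K (φ + ψ) = dualMap K φ + dualMap K ψ := by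
  refine LinearMap.ext fun c => funext fun s => ?_
  by_cases hs : s ∈ K.faces
  · simp only [LinearMap.add_apply, Pi.add_apply, dualMap_apply hs, map_add]
  · simp only [LinearMap.add_apply, Pi.add_apply, dualMap_apply_of_notMem hs, add_zero]

theorem evalChain_dualMap {ψ : Chains V →ₗ[ZMod 2] Chains W} {c : Finset W → ZMod 2}
    (hempty : evalChain c (ψ (simplex ∅)) = 0) {x : Chains V}
    (hx : x ∈ chainsOn (insert ∅ K.faces)) : evalChain (dualMap K ψ c) x = evalChain c (ψ x) := by
  suffices h : chainsOn (insert ∅ K.faces) ≤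
      LinearMap.eqLocus (evalChain (dualMap K ψ c)) (evalChain c ∘ₗ ψ) from h hx
  refine chainsOn_le fun s hs => ?_
  rw [LinearMap.mem_eqLocus, evalChain_simplex, LinearMap.comp_apply]
  obtain rfl | hs := hs
  · rw [dualMap_apply_of_notMem (empty_notMem_faces K), hempty]
  · exact dualMap_apply hs ψ c

theorem dualMap_dualMap {U : Type*} {φ : Chains V →ₗ[ZMod 2] Chains W}
    {ψ : Chains W →ₗ[ZMod 2] Chains U}
    (hφ : ∀ s ∈ K.faces, φ (simplex s) ∈ chainsOn (insert ∅ L.faces)) {c : Finset U → ZMod 2}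
    (hempty : evalChain c (ψ (simplex ∅)) = 0) :
    dualMap K φ (dualMap L ψ c) = dualMap K (ψ ∘ₗ φ) c := by
  funext s
  by_cases hs : s ∈ K.faces
  · rw [dualMap_apply hs, dualMap_apply hs, evalChain_dualMap hempty (hφ s hs),
      LinearMap.comp_apply]
  · rw [dualMap_apply_of_notMem hs, dualMap_apply_of_notMem hs]

theorem dualMap_mem_relCochains {φ : Chains V →ₗ[ZMod 2] Chains W} {d : ℤ}
    (hφ : ∀ s ∈ K.faces, φ (simplex s) ∈
      chainsOn {t | (s ∈ A.faces → t ∈ B.faces) ∧ (t.card : ℤ) = s.card + d})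
    {k : ℤ} {c : Finset W → ZMod 2} (hc : c ∈ relCochains L B (k + d)) :
    dualMap K φ c ∈ relCochains K A k := by
  intro s hs
  by_cases hK : s ∈ K.faces
  · rw [dualMap_apply hK]
    exact evalChain_eq_zero (fun t ht => hc t fun h =>
      hs ⟨hK, mt ht.1 h.2.1, by have := ht.2; omega⟩) (hφ s hK)
  · exact dualMap_apply_of_notMem hK φ c

theorem relCochains_empty {k : ℤ} {c : Finset V → ZMod 2} (hc : c ∈ relCochains K A k) :
    c ∅ = 0 :=
  hc ∅ fun h => empty_notMem_faces K h.1

theorem dualMap_id {k : ℤ} {c : Finset V → ZMod 2} (hc : c ∈ relCochains K A k) :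
    dualMap K LinearMap.id c = c := by
  funext s
  by_cases hs : s ∈ K.faces
  · rw [dualMap_apply hs, LinearMap.id_apply, evalChain_simplex]
  · rw [dualMap_apply_of_notMem hs, hc s fun h => hs h.1]

theorem coboundary_eq_dualMap (K : PreAbstractSimplicialComplex V) :
    coboundary K = dualMap K (chainBoundary V) := by
  refine LinearMap.ext fun c => funext fun s => ?_
  by_cases hs : s ∈ K.faces
  · rw [dualMap_apply hs, chainBoundary_simplex, map_sum]
    simp only [coboundary, LinearMap.coe_mk, AddHom.coe_mk, if_pos hs, evalChain_simplex]
  · rw [dualMap_apply_of_notMem hs]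
    exact if_neg hs

theorem pullback_eq_dualMap {oK : VertexOrder K} {oL : VertexOrder L} (f : OrderedMap oK A oL B)
    (c : Finset W → ZMod 2) : pullback f c = dualMap K (pushforward f.toFun) c := by
  funext s
  by_cases hs : s ∈ K.faces
  · rw [dualMap_apply hs, pushforward_simplex, pullback]
    by_cases hinj : Set.InjOn f.toFun (s : Set V)
    · rw [if_pos ⟨hs, hinj⟩, if_pos hinj, evalChain_simplex]
    · rw [if_neg (fun h => hinj h.2), if_neg hinj, map_zero]
  · rw [dualMap_apply_of_notMem hs, pullback, if_neg fun h => hs h.1]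

theorem chainBoundary_simplex_mem_faces {s : Finset V} (hs : s ∈ K.faces) :
    chainBoundary V (simplex s) ∈ chainsOn (insert ∅ K.faces) :=
  chainBoundary_simplex_mem (isLowerSet_insert_empty_faces K) (Or.inr hs)

theorem coboundary_coboundary (c : Finset V → ZMod 2) :
    coboundary K (coboundary K c) = 0 := by
  rw [coboundary_eq_dualMap, dualMap_dualMap (fun s => chainBoundary_simplex_mem_faces)
    (by rw [chainBoundary_simplex_empty, map_zero])]
  funext s
  by_cases hs : s ∈ K.faces
  · rw [dualMap_apply hs, LinearMap.comp_apply, chainBoundary_chainBoundary, map_zero,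
      Pi.zero_apply]
  · exact dualMap_apply_of_notMem hs _ c

theorem coboundary_dualMap {φ : Chains V →ₗ[ZMod 2] Chains W}
    (hφ : ∀ s ∈ (insert ∅ K.faces : Set (Finset V)), φ (simplex s) ∈ chainsOn (insert ∅ L.faces))
    (hcomm : ∀ s ∈ K.faces,
      chainBoundary W (φ (simplex s)) = φ (chainBoundary V (simplex s)))
    {c : Finset W → ZMod 2} (hempty : evalChain c (φ (simplex ∅)) = 0) :
    coboundary K (dualMap K φ c) = dualMap K φ (coboundary L c) := by
  rw [coboundary_eq_dualMap, coboundary_eq_dualMap,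
    dualMap_dualMap (fun s => chainBoundary_simplex_mem_faces) hempty,
    dualMap_dualMap (fun s hs => hφ s (Or.inr hs))
      (by rw [chainBoundary_simplex_empty, map_zero])]
  exact LinearMap.congr_fun (dualMap_congr fun s hs => (hcomm s hs).symm) c

end DualMaps

/-! ### Subdivision of cochains -/

section SubdivisionCochains

variable {K A : PreAbstractSimplicialComplex V}

theorem mem_sdSub_of_mem_flags {S : Set {s : Finset V // s ∈ K.faces}}
    (hS : ∀ g ∈ S, g.1 ∈ A.faces) {k : ℕ} (hk : k ≠ 0) {G : Finset {s : Finset V // s ∈ K.faces}}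
    (hG : G ∈ flags S k) : G ∈ (sdSub K A).faces :=
  ⟨Finset.card_ne_zero.1 (hG.2.1 ▸ hk), hG.1, fun g hg => hS g (hG.2.2 hg)⟩

theorem flags_subset_sd (S : Set {s : Finset V // s ∈ K.faces}) (k : ℕ) :
    flags S k ⊆ insert ∅ (sd K).faces :=
  fun G hG => G.eq_empty_or_nonempty.imp id fun h => ⟨h, hG.1, fun g _ => g.2⟩

theorem isChain_of_mem_insert_sd {F : Finset {s : Finset V // s ∈ K.faces}}
    (hF : F ∈ (insert ∅ (sd K).faces : Set _)) :
    IsChain (· ≤ ·) (F : Set {s : Finset V // s ∈ K.faces}) := by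
  obtain rfl | hF := hF
  · rw [Finset.coe_empty]
    exact IsChain.empty
  · exact hF.2.1

theorem sdChain_simplex_mem_sd {s : Finset V} (hs : s ∈ (insert ∅ K.faces : Set (Finset V))) :
    sdChain K (simplex s) ∈ chainsOn (insert ∅ (sd K).faces) :=
  Finsupp.supported_mono (flags_subset_sd _ _) (sdChain_simplex_mem_flags hs)

/-- The map on cochains dual to barycentric subdivision. -/
noncomputable def sdCochain (K : PreAbstractSimplicialComplex V) :
    (Finset {s : Finset V // s ∈ K.faces} → ZMod 2) →ₗ[ZMod 2] (Finset V → ZMod 2) :=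
  dualMap K (sdChain K)

variable {k : ℤ} {c : Finset {s : Finset V // s ∈ K.faces} → ZMod 2}

theorem sdCochain_mem (hc : c ∈ relCochains (sd K) (sdSub K A) k) :
    sdCochain K c ∈ relCochains K A k := by
  rw [← add_zero k] at hc
  refine dualMap_mem_relCochains (fun s hs => ?_) hc
  refine Finsupp.supported_mono ?_ (sdChain_simplex_mem_flags (Or.inr hs))
  refine fun G hG => ⟨fun hA => ?_, ?_⟩
  · exact mem_sdSub_of_mem_flags
      (fun g hg => (A.isRelLowerSet_faces hA).2 hg (K.isRelLowerSet_faces g.2).1)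
      (K.isRelLowerSet_faces hs).1.card_pos.ne' hG
  · rw [hG.2.1, add_zero]

theorem coboundary_sdCochain (hc : c ∅ = 0) :
    coboundary K (sdCochain K c) = sdCochain K (coboundary (sd K) c) :=
  coboundary_dualMap (fun _ => sdChain_simplex_mem_sd)
    (fun _ hs => chainBoundary_sdChain (simplex_mem_chainsOn (Or.inr hs)))
    (by rw [sdChain_simplex_empty, evalChain_simplex, hc])

variable (o : VertexOrder K)

theorem sdCochain_pullback {z : Finset V → ZMod 2} (hz : z ∈ relCochains K A k) :
    sdCochain K (pullback (barycentricMap o A) z) = z := by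
  calc sdCochain K (pullback (barycentricMap o A) z)
      = dualMap K (pushforward o.maxVertex ∘ₗ sdChain K) z := by
        rw [pullback_eq_dualMap]
        exact dualMap_dualMap (fun s hs => sdChain_simplex_mem_sd (Or.inr hs))
          (by rw [barycentricMap, pushforward_simplex_empty, evalChain_simplex,
            relCochains_empty hz])
    _ = dualMap K LinearMap.id z := LinearMap.congr_fun (dualMap_congr fun s hs =>
        pushforward_sdChain o (simplex_mem_chainsOn (Or.inr hs))) z
    _ = z := dualMap_id hz

theorem pushforward_maxVertex_simplex {F : Finset {s : Finset V // s ∈ K.faces}}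
    (hF : IsChain (· ≤ ·) (F : Set {s : Finset V // s ∈ K.faces})) :
    pushforward o.maxVertex (simplex F) ∈ chainsOn {s | s ∈ (insert ∅ K.faces : Set (Finset V)) ∧
      s.card = F.card ∧ ∀ v ∈ s, ∃ g ∈ F, v ∈ g.1} := by
  rw [pushforward_simplex]
  split_ifs with hinj
  · refine simplex_mem_chainsOn ⟨?_, Finset.card_image_of_injOn hinj, ?_⟩
    · obtain rfl | hne := F.eq_empty_or_nonempty
      · exact Or.inl (Finset.image_empty _)
      · exact Or.inr (o.image_maxVertex_mem K F ⟨hne, hF, fun g _ => g.2⟩)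
    · intro v hv
      obtain ⟨g, hg, rfl⟩ := Finset.mem_image.1 hv
      exact ⟨g, hg, o.maxVertex_mem g⟩
  · exact Submodule.zero_mem _

theorem pushforward_maxVertex_simplex_mem {F : Finset {s : Finset V // s ∈ K.faces}}
    (hF : F ∈ (insert ∅ (sd K).faces : Set _)) :
    pushforward o.maxVertex (simplex F) ∈ chainsOn (insert ∅ K.faces) :=
  Finsupp.supported_mono (fun _ h => h.1)
    (pushforward_maxVertex_simplex o (isChain_of_mem_insert_sd hF))

/-- The chain map of the subdivision that is induced by the maximum vertex map followed by
subdivision. -/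
noncomputable def sdMax :
    Chains {s : Finset V // s ∈ K.faces} →ₗ[ZMod 2] Chains {s : Finset V // s ∈ K.faces} :=
  sdChain K ∘ₗ pushforward o.maxVertex

theorem sdMax_simplex_empty : sdMax o (simplex ∅) = simplex ∅ := by
  rw [sdMax, LinearMap.comp_apply, pushforward_simplex_empty, sdChain_simplex_empty]

theorem chainBoundary_sdMax {F : Finset {s : Finset V // s ∈ K.faces}}
    (hF : IsChain (· ≤ ·) (F : Set {s : Finset V // s ∈ K.faces})) :
    chainBoundary _ (sdMax o (simplex F)) = sdMax o (chainBoundary _ (simplex F)) := by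
  rw [sdMax, LinearMap.comp_apply, LinearMap.comp_apply, pushforward_chainBoundary,
    chainBoundary_sdChain (Finsupp.supported_mono (fun _ h => h.1)
      (pushforward_maxVertex_simplex o hF))]

theorem sdMax_mem_flags {F : Finset {s : Finset V // s ∈ K.faces}}
    (hF : IsChain (· ≤ ·) (F : Set {s : Finset V // s ∈ K.faces})) :
    sdMax o (simplex F) ∈
      chainsOn (flags (lowerClosure (F : Set {s : Finset V // s ∈ K.faces})) F.card) := by
  suffices h : chainsOn {s | s ∈ (insert ∅ K.faces : Set (Finset V)) ∧
      s.card = F.card ∧ ∀ v ∈ s, ∃ g ∈ F, v ∈ g.1} ≤ (chainsOn (flags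
        (lowerClosure (F : Set {s : Finset V // s ∈ K.faces})) F.card)).comap (sdChain K) from
    h (pushforward_maxVertex_simplex o hF)
  refine chainsOn_le fun s ⟨hs, hcard, hsF⟩ => ?_
  rw [Submodule.mem_comap, ← hcard]
  refine Finsupp.supported_mono (flags_mono (fun g hg => ?_) _) (sdChain_simplex_mem_flags hs)
  obtain ⟨v, hv⟩ := (K.isRelLowerSet_faces g.2).1
  obtain ⟨g₀, hg₀, -⟩ := hsF v (hg hv)
  obtain ⟨t, ht, htop⟩ := exists_isGreatest_of_isChain hF ⟨g₀, hg₀⟩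
  refine ⟨t, ht, fun w hw => ?_⟩
  obtain ⟨r, hr, hwr⟩ := hsF w (hg hw)
  exact htop hr hwr

theorem coneHomotopy_sdMax_mem_flags {F : Finset {s : Finset V // s ∈ K.faces}}
    (hF : IsChain (· ≤ ·) (F : Set {s : Finset V // s ∈ K.faces})) :
    coneHomotopy (sdMax o) (simplex F) ∈
      chainsOn (flags (lowerClosure (F : Set {s : Finset V // s ∈ K.faces})) (F.card + 1)) :=
  coneHomotopy_mem_flags (fun _ hG => sdMax_mem_flags o hG) F hF

/-- The cochain homotopy between the identity and `b^* ∘ sd^*`. -/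
noncomputable def sdHomotopy : (Finset {s : Finset V // s ∈ K.faces} → ZMod 2) →ₗ[ZMod 2]
    (Finset {s : Finset V // s ∈ K.faces} → ZMod 2) :=
  dualMap (sd K) (coneHomotopy (sdMax o))

theorem sdHomotopy_mem (hc : c ∈ relCochains (sd K) (sdSub K A) (k + 1)) :
    sdHomotopy o c ∈ relCochains (sd K) (sdSub K A) k := by
  refine dualMap_mem_relCochains (fun F hF => ?_) hc
  refine Finsupp.supported_mono ?_ (coneHomotopy_sdMax_mem_flags o hF.2.1)
  refine fun G hG => ⟨fun hA => ?_, ?_⟩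
  · refine mem_sdSub_of_mem_flags (fun g hg => ?_) (Nat.succ_ne_zero _) hG
    obtain ⟨s, hs, hgs⟩ := hg
    exact (A.isRelLowerSet_faces (hA.2.2 s hs)).2 hgs (K.isRelLowerSet_faces g.2).1
  · rw [hG.2.1, Nat.cast_add, Nat.cast_one]

theorem pullback_sdCochain (hc : c ∈ relCochains (sd K) (sdSub K A) k) :
    pullback (barycentricMap o A) (sdCochain K c) =
      c + coboundary (sd K) (sdHomotopy o c) + sdHomotopy o (coboundary (sd K) c) := by
  have hempty : c ∅ = 0 := relCochains_empty hc
  have hpull : pullback (barycentricMap o A) (sdCochain K c) = dualMap (sd K) (sdMax o) c := by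
    rw [pullback_eq_dualMap]
    exact dualMap_dualMap (fun F hF => pushforward_maxVertex_simplex_mem o (Or.inr hF))
      (by rw [sdChain_simplex_empty, evalChain_simplex, hempty])
  have hdh : coboundary (sd K) (sdHomotopy o c) =
      dualMap (sd K) (coneHomotopy (sdMax o) ∘ₗ chainBoundary _) c := by
    rw [coboundary_eq_dualMap]
    exact dualMap_dualMap (fun _ => chainBoundary_simplex_mem_faces)
      (by rw [coneHomotopy_simplex_empty, map_zero])
  have hhd : sdHomotopy o (coboundary (sd K) c) =
      dualMap (sd K) (chainBoundary _ ∘ₗ coneHomotopy (sdMax o)) c := by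
    rw [coboundary_eq_dualMap]
    refine dualMap_dualMap (fun F hF => ?_) (by rw [chainBoundary_simplex_empty, map_zero])
    exact Finsupp.supported_mono (flags_subset_sd _ _) (coneHomotopy_sdMax_mem_flags o hF.2.1)
  calc pullback (barycentricMap o A) (sdCochain K c)
      = dualMap (sd K) (LinearMap.id + coneHomotopy (sdMax o) ∘ₗ chainBoundary _ +
          chainBoundary _ ∘ₗ coneHomotopy (sdMax o)) c := by
        refine hpull.trans (LinearMap.congr_fun (dualMap_congr fun F hF => ?_) c)
        have key := chainBoundary_coneHomotopy (sdMax_simplex_empty o)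
          (fun G hG => chainBoundary_sdMax o hG) (simplex_mem_chainsOn (s := F) hF.2.1)
        simp only [LinearMap.add_apply, LinearMap.comp_apply, LinearMap.id_apply]
        rw [add_assoc, add_comm (coneHomotopy _ _), key, ← add_assoc, ZModModule.add_self,
          zero_add]
    _ = c + coboundary (sd K) (sdHomotopy o c) + sdHomotopy o (coboundary (sd K) c) := by
        rw [dualMap_add, dualMap_add, LinearMap.add_apply, LinearMap.add_apply, dualMap_id hc, hdh,
          hhd]

end SubdivisionCochains

/-! ### Steenrod's coboundary formula -/

section Steenrod

variable {K : PreAbstractSimplicialComplex V} (o : VertexOrder K)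

theorem VertexOrder.mem_leftPart {T s : Finset V} {v : V} :
    v ∈ o.leftPart T s ↔ v ∈ s ∧ (v ∈ T ∨ Even (o.below T v)) :=
  Finset.mem_filter

theorem VertexOrder.mem_rightPart {T s : Finset V} {v : V} :
    v ∈ o.rightPart T s ↔ v ∈ s ∧ (v ∈ T ∨ Odd (o.below T v)) :=
  Finset.mem_filter

theorem VertexOrder.leftPart_subset (T s : Finset V) : o.leftPart T s ⊆ s :=
  Finset.filter_subset _ _

theorem VertexOrder.rightPart_subset (T s : Finset V) : o.rightPart T s ⊆ s :=
  Finset.filter_subset _ _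

theorem VertexOrder.leftPart_erase (T s : Finset V) (v : V) :
    o.leftPart T (s.erase v) = (o.leftPart T s).erase v :=
  Finset.filter_erase _ _ _

theorem VertexOrder.rightPart_erase (T s : Finset V) (v : V) :
    o.rightPart T (s.erase v) = (o.rightPart T s).erase v :=
  Finset.filter_erase _ _ _

theorem VertexOrder.below_insert {T : Finset V} {t : V} (ht : t ∉ T) (v : V) :
    o.below (insert t T) v = o.below T v + if o.order.lt t v then 1 else 0 := by
  unfold VertexOrder.below
  rw [Finset.filter_insert]
  split_ifs with h
  · rw [Finset.card_insert_of_notMem fun h' => ht (Finset.mem_filter.1 h').1]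
  · rfl

theorem VertexOrder.below_lt_below {s : Finset V} {v w : V} (hv : v ∈ s)
    (h : o.order.lt v w) : o.below s v < o.below s w := by
  let _ := o.order
  refine Finset.card_lt_card (Finset.ssubset_iff_of_subset ?_ |>.2 ⟨v, ?_, ?_⟩)
  · exact Finset.monotone_filter_right s fun u _ hu => lt_trans hu h
  · exact Finset.mem_filter.2 ⟨hv, h⟩
  · exact fun h' => lt_irrefl v (Finset.mem_filter.1 h').2

theorem VertexOrder.below_lt_card {s : Finset V} {v : V} (hv : v ∈ s) : o.below s v < s.card := by
  let _ := o.order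
  exact Finset.card_lt_card (Finset.filter_ssubset.2 ⟨v, hv, lt_irrefl v⟩)

theorem VertexOrder.lt_or_lt {s : Finset V} (hs : s ∈ K.faces) {v w : V} (hv : v ∈ s)
    (hw : w ∈ s) (hne : v ≠ w) : o.order.lt v w ∨ o.order.lt w v := by
  let _ := o.order
  exact (o.total s hs v hv w hw).imp (fun h => lt_of_le_of_ne h hne)
    fun h => lt_of_le_of_ne h hne.symm

theorem VertexOrder.lt_iff_below_lt {s : Finset V} (hs : s ∈ K.faces) {v w : V} (hv : v ∈ s)
    (hw : w ∈ s) : o.order.lt v w ↔ o.below s v < o.below s w := by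
  refine ⟨o.below_lt_below hv, fun h => ?_⟩
  have hne : v ≠ w := fun hvw => h.ne (by rw [hvw])
  exact (o.lt_or_lt hs hv hw hne).resolve_right fun h' => h.not_gt (o.below_lt_below hw h')

theorem VertexOrder.below_injOn {s : Finset V} (hs : s ∈ K.faces) :
    Set.InjOn (o.below s) (s : Set V) := by
  intro v hv w hw h
  by_contra hne
  rcases o.lt_or_lt hs hv hw hne with h' | h'
  · exact (o.below_lt_below hv h').ne h
  · exact (o.below_lt_below hw h').ne h.symm

theorem VertexOrder.sum_below {s : Finset V} (hs : s ∈ K.faces) (f : ℕ → ZMod 2) :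
    ∑ v ∈ s, f (o.below s v) = ∑ j ∈ Finset.range s.card, f j := by
  have h : s.image (o.below s) = Finset.range s.card := by
    refine Finset.eq_of_subset_of_card_le (Finset.image_subset_iff.2 fun v hv => ?_) ?_
    · exact Finset.mem_range.2 (o.below_lt_card hv)
    · rw [Finset.card_image_of_injOn (o.below_injOn hs), Finset.card_range]
  rw [← h, Finset.sum_image (o.below_injOn hs)]

/-- The part of `s` that an additional cut between two vertices, at the `j`-th gap of `s`, makes
alternate from its first (`ε = 0`) or second (`ε = 1`) factor. For `j = s.card` there is no
additional cut. -/
noncomputable def VertexOrder.gapPart (ε : ℕ) (T s : Finset V) (j : ℕ) : Finset V :=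
  s.filter fun v => v ∈ T ∨ Even (o.below T v + ε + if j ≤ o.below s v then 1 else 0)

theorem VertexOrder.gapPart_zero_zero (T s : Finset V) : o.gapPart 0 T s 0 = o.rightPart T s := by
  refine Finset.filter_congr fun v _ => ?_
  rw [add_zero, if_pos (Nat.zero_le _), Nat.even_add_one, Nat.not_even_iff_odd]

theorem VertexOrder.gapPart_one_zero (T s : Finset V) : o.gapPart 1 T s 0 = o.leftPart T s := by
  refine Finset.filter_congr fun v _ => ?_
  rw [if_pos (Nat.zero_le _), Nat.even_add_one, Nat.even_add_one, not_not]

theorem VertexOrder.gapPart_zero_card (T s : Finset V) :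
    o.gapPart 0 T s s.card = o.leftPart T s := by
  refine Finset.filter_congr fun v hv => ?_
  rw [if_neg (o.below_lt_card hv).not_ge, add_zero, add_zero]

theorem VertexOrder.gapPart_one_card (T s : Finset V) :
    o.gapPart 1 T s s.card = o.rightPart T s := by
  refine Finset.filter_congr fun v hv => ?_
  rw [if_neg (o.below_lt_card hv).not_ge, add_zero, Nat.even_add_one, Nat.not_even_iff_odd]

theorem VertexOrder.gapPart_below_add_one_of_mem {T s : Finset V} (hs : s ∈ K.faces) {t : V}
    (ht : t ∈ s) (htT : t ∈ T) (ε : ℕ) :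
    o.gapPart ε T s (o.below s t + 1) = o.gapPart ε T s (o.below s t) := by
  refine Finset.filter_congr fun v hv => or_congr_right' fun hvT => ?_
  have hne : o.below s t ≠ o.below s v := fun h => hvT (o.below_injOn hs ht hv h ▸ htT)
  simp only [Nat.succ_le_iff, hne.le_iff_lt]

theorem VertexOrder.gapPart_of_notMem {T s : Finset V} {t : V} (ht : t ∈ s) (htT : t ∉ T) {j : ℕ}
    (hj : ∀ v ∈ s, v ≠ t → (j ≤ o.below s v ↔ o.order.lt t v)) (ε : ℕ) :
    o.gapPart ε T s j =
      if Even (o.below T t + ε + if j ≤ o.below s t then 1 else 0)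
        then o.gapPart ε (insert t T) s s.card
        else (o.gapPart ε (insert t T) s s.card).erase t := by
  have hne : ∀ v ∈ s, v ≠ t →
      (v ∈ o.gapPart ε T s j ↔ v ∈ o.gapPart ε (insert t T) s s.card) := by
    intro v hv hvt
    simp only [VertexOrder.gapPart, Finset.mem_filter, Finset.mem_insert, hvt, false_or,
      o.below_insert htT, hj v hv hvt, if_neg (o.below_lt_card hv).not_ge, add_zero,
      add_right_comm]
  have hmem : t ∈ o.gapPart ε T s j ↔
      Even (o.below T t + ε + if j ≤ o.below s t then 1 else 0) := by
    simp only [VertexOrder.gapPart, Finset.mem_filter, ht, htT, true_and, false_or]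
  have hmem' : t ∈ o.gapPart ε (insert t T) s s.card := by
    simp only [VertexOrder.gapPart, Finset.mem_filter, ht, Finset.mem_insert_self, true_or,
      and_true]
  ext v
  by_cases hvs : v ∈ s
  · by_cases hvt : v = t
    · subst hvt
      rw [hmem]
      by_cases h : Even (o.below T v + ε + if j ≤ o.below s v then 1 else 0)
      · rw [if_pos h]
        exact iff_of_true h hmem'
      · rw [if_neg h]
        exact iff_of_false h (Finset.notMem_erase v _)
    · rw [hne v hvs hvt]
      split_ifs <;> simp [hvt]
  · have hnot : ∀ (T' : Finset V) (j' : ℕ), v ∉ o.gapPart ε T' s j' := fun T' j' h =>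
      hvs (Finset.mem_filter.1 h).1
    split_ifs <;> simp [hnot]

theorem VertexOrder.mul_gapPart_add_of_notMem {T s : Finset V} (hs : s ∈ K.faces) {t : V}
    (ht : t ∈ s) (htT : t ∉ T) (x y : Finset V → ZMod 2) :
    x (o.gapPart 0 T s (o.below s t)) * y (o.gapPart 1 T s (o.below s t)) +
      x (o.gapPart 0 T s (o.below s t + 1)) * y (o.gapPart 1 T s (o.below s t + 1)) =
    x ((o.leftPart (insert t T) s).erase t) * y (o.rightPart (insert t T) s) +
      x (o.leftPart (insert t T) s) * y ((o.rightPart (insert t T) s).erase t) := by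
  have hlt : ∀ v ∈ s, v ≠ t → (o.below s t + 1 ≤ o.below s v ↔ o.order.lt t v) := fun v hv _ =>
    (o.lt_iff_below_lt hs ht hv).symm
  have hle : ∀ v ∈ s, v ≠ t → (o.below s t ≤ o.below s v ↔ o.order.lt t v) := by
    intro v hv hvt
    have hne : o.below s t ≠ o.below s v := fun h => hvt (o.below_injOn hs ht hv h).symm
    rw [hne.le_iff_lt, o.lt_iff_below_lt hs ht hv]
  simp only [o.gapPart_of_notMem ht htT hlt, o.gapPart_of_notMem ht htT hle,
    o.gapPart_zero_card, o.gapPart_one_card, le_refl, if_true,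
    Nat.not_succ_le_self, if_false, add_zero, Nat.even_add_one, not_not]
  by_cases he : Even (o.below T t)
  · simp only [he, not_true_eq_false, if_true, if_false]
  · simp only [he, not_false_eq_true, if_true, if_false, add_comm]

theorem sum_range_add_succ (f : ℕ → ZMod 2) (m : ℕ) :
    ∑ j ∈ Finset.range m, (f j + f (j + 1)) = f m + f 0 := by
  simpa only [CharTwo.sub_eq_add, add_comm (f (_ + 1))] using Finset.sum_range_sub f m

theorem VertexOrder.sum_leftPart_rightPart_insert {T s : Finset V} (hs : s ∈ K.faces)
    (x y : Finset V → ZMod 2) :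
    ∑ t ∈ s \ T, (x ((o.leftPart (insert t T) s).erase t) * y (o.rightPart (insert t T) s) +
      x (o.leftPart (insert t T) s) * y ((o.rightPart (insert t T) s).erase t)) =
    x (o.leftPart T s) * y (o.rightPart T s) + y (o.leftPart T s) * x (o.rightPart T s) := by
  -- Moving the additional cut vertex through `s` telescopes.
  let g : ℕ → ZMod 2 := fun j => x (o.gapPart 0 T s j) * y (o.gapPart 1 T s j)
  calc _ = ∑ t ∈ s \ T, (g (o.below s t) + g (o.below s t + 1)) := by
        refine Finset.sum_congr rfl fun t ht => ?_
        rw [Finset.mem_sdiff] at ht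
        exact (o.mul_gapPart_add_of_notMem hs ht.1 ht.2 x y).symm
    _ = ∑ t ∈ s, (g (o.below s t) + g (o.below s t + 1)) := by
        refine Finset.sum_subset Finset.sdiff_subset fun t ht htT => ?_
        have htT' : t ∈ T := by simpa only [Finset.mem_sdiff, ht, true_and, not_not] using htT
        simp only [g, o.gapPart_below_add_one_of_mem hs ht htT', CharTwo.add_self_eq_zero]
    _ = ∑ j ∈ Finset.range s.card, (g j + g (j + 1)) :=
        o.sum_below hs fun j => g j + g (j + 1)
    _ = g s.card + g 0 := sum_range_add_succ g s.card
    _ = _ := by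
        simp only [g, o.gapPart_zero_zero, o.gapPart_one_zero, o.gapPart_zero_card,
          o.gapPart_one_card]
        rw [mul_comm (x (o.rightPart T s))]

/-- The sets of cut vertices over which the product `∪_i` on `s` is summed. -/
noncomputable def cutSets (s : Finset V) (i : ℤ) : Finset (Finset V) :=
  s.powerset.filter fun T => (T.card : ℤ) = i + 1

theorem mem_cutSets {s T : Finset V} {i : ℤ} :
    T ∈ cutSets s i ↔ T ⊆ s ∧ (T.card : ℤ) = i + 1 := by
  rw [cutSets, Finset.mem_filter, Finset.mem_powerset]

theorem sum_cutSets_sum_mem (s : Finset V) (i : ℤ) (f : Finset V → V → ZMod 2) :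
    ∑ T ∈ cutSets s i, ∑ v ∈ T, f T v =
      ∑ T ∈ cutSets s (i - 1), ∑ v ∈ s \ T, f (insert v T) v := by
  rw [Finset.sum_sigma', Finset.sum_sigma']
  refine Finset.sum_bij' (fun a _ => ⟨a.1.erase a.2, a.2⟩) (fun a _ => ⟨insert a.2 a.1, a.2⟩)
    ?_ ?_ ?_ ?_ ?_ <;>
    rintro ⟨T, v⟩ h <;>
    simp only [Finset.mem_sigma, mem_cutSets, Finset.mem_sdiff] at h ⊢
  · refine ⟨⟨(Finset.erase_subset _ _).trans h.1.1, ?_⟩, h.1.1 h.2, Finset.notMem_erase _ _⟩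
    have := Finset.card_erase_add_one h.2
    omega
  · refine ⟨⟨Finset.insert_subset h.2.1 h.1.1, ?_⟩, Finset.mem_insert_self _ _⟩
    rw [Finset.card_insert_of_notMem h.2.2]
    omega
  · rw [Finset.insert_erase h.2]
  · rw [Finset.erase_insert h.2.2]
  · rw [Finset.insert_erase h.2]

theorem cup_apply {s : Finset V} (hs : s ∈ K.faces) (i : ℤ) (x y : Finset V → ZMod 2) :
    cup o i x y s = ∑ T ∈ cutSets s i, x (o.leftPart T s) * y (o.rightPart T s) :=
  if_pos hs

theorem cup_apply_of_notMem {s : Finset V} (hs : s ∉ K.faces) (i : ℤ) (x y : Finset V → ZMod 2) :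
    cup o i x y s = 0 :=
  if_neg hs

theorem coboundary_apply {s : Finset V} (hs : s ∈ K.faces) (x : Finset V → ZMod 2) :
    coboundary K x s = ∑ v ∈ s, x (s.erase v) :=
  if_pos hs

theorem coboundary_apply_of_notMem {s : Finset V} (hs : s ∉ K.faces) (x : Finset V → ZMod 2) :
    coboundary K x s = 0 :=
  if_neg hs

theorem coboundary_apply_of_subset {s t : Finset V} (hs : s ∈ K.faces) (ht : t ⊆ s)
    (x : Finset V → ZMod 2) :
    coboundary K x t = ∑ v ∈ s, if v ∈ t then x (t.erase v) else 0 := by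
  rw [← Finset.sum_filter, Finset.filter_mem_eq_inter, Finset.inter_eq_right.2 ht]
  obtain rfl | hne := t.eq_empty_or_nonempty
  · rw [coboundary_apply_of_notMem (empty_notMem_faces K), Finset.sum_empty]
  · exact coboundary_apply ((K.isRelLowerSet_faces hs).2 ht hne) x

theorem coboundary_cup_apply {s : Finset V} (hs : s ∈ K.faces) (i : ℤ) {x : Finset V → ZMod 2}
    (hx : x ∅ = 0) (y : Finset V → ZMod 2) :
    coboundary K (cup o i x y) s = ∑ T ∈ cutSets s i, ∑ v ∈ s \ T,
      x ((o.leftPart T s).erase v) * y ((o.rightPart T s).erase v) := by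
  have hcup : ∀ v, cup o i x y (s.erase v) = ∑ T ∈ cutSets (s.erase v) i,
      x ((o.leftPart T s).erase v) * y ((o.rightPart T s).erase v) := by
    intro v
    simp only [← o.leftPart_erase, ← o.rightPart_erase]
    by_cases h : s.erase v ∈ K.faces
    · exact cup_apply o h i x y
    · have hempty : s.erase v = ∅ := Finset.not_nonempty_iff_eq_empty.1 fun hne =>
        h ((K.isRelLowerSet_faces hs).2 (Finset.erase_subset v s) hne)
      rw [cup_apply_of_notMem o h]
      refine (Finset.sum_eq_zero fun T _ => ?_).symm
      rw [hempty, Finset.subset_empty.1 (o.leftPart_subset T ∅), hx, zero_mul]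
  rw [coboundary_apply hs, Finset.sum_congr rfl fun v _ => hcup v]
  refine Finset.sum_comm' fun v T => ?_
  simp only [mem_cutSets, Finset.mem_sdiff, Finset.subset_erase]
  tauto

theorem coboundary_mul_add_mul_coboundary {s T : Finset V} (hs : s ∈ K.faces) (hT : T ⊆ s)
    (x y : Finset V → ZMod 2) :
    coboundary K x (o.leftPart T s) * y (o.rightPart T s) +
      x (o.leftPart T s) * coboundary K y (o.rightPart T s) =
    ∑ v ∈ s \ T, x ((o.leftPart T s).erase v) * y ((o.rightPart T s).erase v) +
      ∑ v ∈ T, (x ((o.leftPart T s).erase v) * y (o.rightPart T s) +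
        x (o.leftPart T s) * y ((o.rightPart T s).erase v)) := by
  rw [coboundary_apply_of_subset hs (o.leftPart_subset T s),
    coboundary_apply_of_subset hs (o.rightPart_subset T s), Finset.sum_mul, Finset.mul_sum,
    ← Finset.sum_add_distrib, ← Finset.sum_sdiff hT]
  refine congrArg₂ _ (Finset.sum_congr rfl fun v hv => ?_) (Finset.sum_congr rfl fun v hv => ?_)
  · -- A vertex that is not a cut vertex lies in exactly one of the two parts.
    obtain ⟨hvs, hvT⟩ := Finset.mem_sdiff.1 hv
    by_cases h : Even (o.below T v)
    · have hl : v ∈ o.leftPart T s := o.mem_leftPart.2 ⟨hvs, Or.inr h⟩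
      have hr : v ∉ o.rightPart T s := fun h' =>
        Nat.not_odd_iff_even.2 h ((o.mem_rightPart.1 h').2.resolve_left hvT)
      rw [if_pos hl, if_neg hr, Finset.erase_eq_of_notMem hr, mul_zero, add_zero]
    · have hl : v ∉ o.leftPart T s := fun h' => h ((o.mem_leftPart.1 h').2.resolve_left hvT)
      have hr : v ∈ o.rightPart T s :=
        o.mem_rightPart.2 ⟨hvs, Or.inr (Nat.not_even_iff_odd.1 h)⟩
      rw [if_neg hl, if_pos hr, Finset.erase_eq_of_notMem hl, zero_mul, zero_add]
  · rw [if_pos (o.mem_leftPart.2 ⟨hT hv, Or.inl hv⟩),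
      if_pos (o.mem_rightPart.2 ⟨hT hv, Or.inl hv⟩)]

theorem coboundary_cup (i : ℤ) {x : Finset V → ZMod 2} (hx : x ∅ = 0) (y : Finset V → ZMod 2) :
    coboundary K (cup o i x y) = cup o i (coboundary K x) y + cup o i x (coboundary K y) +
      cup o (i - 1) x y + cup o (i - 1) y x := by
  funext s
  simp only [Pi.add_apply]
  by_cases hs : s ∈ K.faces
  swap
  · simp only [coboundary_apply_of_notMem hs, cup_apply_of_notMem o hs, add_zero]
  have hleibniz : cup o i (coboundary K x) y s + cup o i x (coboundary K y) s =
      coboundary K (cup o i x y) s + (cup o (i - 1) x y s + cup o (i - 1) y x s) := by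
    rw [coboundary_cup_apply o hs i hx y, cup_apply o hs, cup_apply o hs, cup_apply o hs,
      cup_apply o hs, ← Finset.sum_add_distrib, ← Finset.sum_add_distrib,
      ← Finset.sum_congr rfl fun T _ => o.sum_leftPart_rightPart_insert hs x y,
      ← sum_cutSets_sum_mem s i fun T v => x ((o.leftPart T s).erase v) * y (o.rightPart T s) +
        x (o.leftPart T s) * y ((o.rightPart T s).erase v),
      ← Finset.sum_add_distrib]
    exact Finset.sum_congr rfl fun T hT =>
      coboundary_mul_add_mul_coboundary o hs (mem_cutSets.1 hT).1 x y
  rw [hleibniz, add_assoc, add_assoc, ZModModule.add_self, add_zero]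

end Steenrod

/-! ### Naturality of the products -/

section CupProducts

variable {K A : PreAbstractSimplicialComplex V} {L B : PreAbstractSimplicialComplex W}
  {o : VertexOrder K} {oL : VertexOrder L}

theorem VertexOrder.card_leftPart_add_card_rightPart (o : VertexOrder K) {T s : Finset V}
    (hT : T ⊆ s) : (o.leftPart T s).card + (o.rightPart T s).card = s.card + T.card := by
  rw [← Finset.card_union_add_card_inter]
  congr 2
  · ext v
    rw [Finset.mem_union, o.mem_leftPart, o.mem_rightPart]
    have := Nat.even_or_odd (o.below T v)
    tauto
  · ext v
    rw [Finset.mem_inter, o.mem_leftPart, o.mem_rightPart, ← Nat.not_even_iff_odd]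
    have := @hT v
    tauto

theorem of_mem_relCochains {k : ℤ} {x : Finset V → ZMod 2} (hx : x ∈ relCochains K A k)
    {s : Finset V} (hs : x s ≠ 0) : s ∈ K.faces ∧ s ∉ A.faces ∧ (s.card : ℤ) = k + 1 :=
  not_not.1 fun h => hs (hx s h)

theorem cup_mem {p q i : ℤ} {x y : Finset V → ZMod 2} (hx : x ∈ relCochains K A p)
    (hy : y ∈ relCochains K A q) : cup o i x y ∈ relCochains K A (p + q - i) := by
  intro s hs
  by_contra hne
  have hK : s ∈ K.faces := by
    by_contra hK
    exact hne (cup_apply_of_notMem o hK i x y)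
  rw [cup_apply o hK] at hne
  obtain ⟨T, hT, hxy⟩ := Finset.exists_ne_zero_of_sum_ne_zero hne
  rw [mem_cutSets] at hT
  obtain ⟨hlK, hlA, hl⟩ := of_mem_relCochains hx (left_ne_zero_of_mul hxy)
  obtain ⟨-, -, hr⟩ := of_mem_relCochains hy (right_ne_zero_of_mul hxy)
  refine hs ⟨hK, fun hA => hlA ?_, ?_⟩
  · exact (A.isRelLowerSet_faces hA).2 (o.leftPart_subset T s) (K.isRelLowerSet_faces hlK).1
  · have := o.card_leftPart_add_card_rightPart hT.1
    omega

theorem cup_add_left (i : ℤ) (x x' y : Finset V → ZMod 2) :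
    cup o i (x + x') y = cup o i x y + cup o i x' y := by
  funext s
  simp only [cup, Pi.add_apply]
  split_ifs
  · simp only [add_mul, Finset.sum_add_distrib]
  · rw [add_zero]

theorem cup_add_right (i : ℤ) (x y y' : Finset V → ZMod 2) :
    cup o i x (y + y') = cup o i x y + cup o i x y' := by
  funext s
  simp only [cup, Pi.add_apply]
  split_ifs
  · simp only [mul_add, Finset.sum_add_distrib]
  · rw [add_zero]

theorem cup_zero_left (i : ℤ) (y : Finset V → ZMod 2) : cup o i 0 y = 0 := by
  funext s
  simp [cup]

theorem cup_zero_right (i : ℤ) (x : Finset V → ZMod 2) : cup o i x 0 = 0 := by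
  funext s
  simp [cup]

theorem OrderedMap.lt_iff (f : OrderedMap o A oL B) {s : Finset V} (hs : s ∈ K.faces)
    (hf : Set.InjOn f.toFun s) {v w : V} (hv : v ∈ s) (hw : w ∈ s) :
    oL.order.lt (f.toFun v) (f.toFun w) ↔ o.order.lt v w := by
  let _ := o.order
  let _ := oL.order
  have hface : ∀ u ∈ s, ({u} : Finset V) ∈ K.faces := fun u hu =>
    (K.isRelLowerSet_faces hs).2 (Finset.singleton_subset_iff.2 hu) (Finset.singleton_nonempty u)
  have hlt : ∀ v ∈ s, ∀ w ∈ s, o.order.lt v w → oL.order.lt (f.toFun v) (f.toFun w) :=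
    fun v hv w hw h => lt_of_le_of_ne (f.mono v w (hface v hv) (hface w hw) h.le)
      fun he => h.ne (hf hv hw he)
  refine ⟨fun h => ?_, hlt v hv w hw⟩
  have hne : v ≠ w := fun hvw => lt_irrefl (f.toFun v) (by rwa [← hvw] at h)
  exact (o.lt_or_lt hs hv hw hne).resolve_right fun h' => lt_asymm h (hlt w hw v hv h')

theorem OrderedMap.below_image (f : OrderedMap o A oL B) {s T : Finset V} (hs : s ∈ K.faces)
    (hf : Set.InjOn f.toFun s) (hT : T ⊆ s) {v : V} (hv : v ∈ s) :
    oL.below (T.image f.toFun) (f.toFun v) = o.below T v := by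
  unfold VertexOrder.below
  rw [Finset.filter_image, Finset.card_image_of_injOn]
  · exact congrArg _ (Finset.filter_congr fun t ht => f.lt_iff hs hf (hT ht) hv)
  · exact hf.mono fun t ht => hT (Finset.mem_filter.1 ht).1

theorem OrderedMap.leftPart_image (f : OrderedMap o A oL B) {s T : Finset V} (hs : s ∈ K.faces)
    (hf : Set.InjOn f.toFun s) (hT : T ⊆ s) :
    oL.leftPart (T.image f.toFun) (s.image f.toFun) = (o.leftPart T s).image f.toFun := by
  unfold VertexOrder.leftPart
  rw [Finset.filter_image]
  refine congrArg _ (Finset.filter_congr fun v hv => ?_)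
  rw [f.below_image hs hf hT hv, ← Finset.mem_coe, Finset.coe_image, hf.mem_image_iff hT hv,
    Finset.mem_coe]

theorem OrderedMap.rightPart_image (f : OrderedMap o A oL B) {s T : Finset V} (hs : s ∈ K.faces)
    (hf : Set.InjOn f.toFun s) (hT : T ⊆ s) :
    oL.rightPart (T.image f.toFun) (s.image f.toFun) = (o.rightPart T s).image f.toFun := by
  unfold VertexOrder.rightPart
  rw [Finset.filter_image]
  refine congrArg _ (Finset.filter_congr fun v hv => ?_)
  rw [f.below_image hs hf hT hv, ← Finset.mem_coe, Finset.coe_image, hf.mem_image_iff hT hv,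
    Finset.mem_coe]

theorem cutSets_image {f : V → W} {s : Finset V} (hf : Set.InjOn f s) (i : ℤ) :
    cutSets (s.image f) i = (cutSets s i).image (Finset.image f) := by
  unfold cutSets
  rw [Finset.powerset_image, Finset.filter_image]
  refine congrArg _ (Finset.filter_congr fun T hT => ?_)
  rw [Finset.card_image_of_injOn (hf.mono (Finset.coe_subset.2 (Finset.mem_powerset.1 hT)))]

theorem pullback_apply_of_injOn (f : OrderedMap o A oL B) {s t : Finset V} (hs : s ∈ K.faces)
    (hf : Set.InjOn f.toFun s) (ht : t ⊆ s) {z : Finset W → ZMod 2} (hz : z ∅ = 0) :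
    pullback f z t = z (t.image f.toFun) := by
  obtain rfl | hne := t.eq_empty_or_nonempty
  · rw [Finset.image_empty, hz]
    exact if_neg fun h => empty_notMem_faces K h.1
  · exact if_pos ⟨(K.isRelLowerSet_faces hs).2 ht hne, hf.mono (Finset.coe_subset.2 ht)⟩

theorem pullback_cup_apply_of_injOn (f : OrderedMap o A oL B) (i : ℤ) {x y : Finset W → ZMod 2}
    (hx : x ∅ = 0) (hy : y ∅ = 0) {s : Finset V} (hs : s ∈ K.faces)
    (hf : Set.InjOn f.toFun s) :
    pullback f (cup oL i x y) s = cup o i (pullback f x) (pullback f y) s := by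
  have hinj : Set.InjOn (Finset.image f.toFun) (cutSets s i) :=
    (Finset.image_injOn_powerset_of_injOn hf).mono (Finset.coe_subset.2 (Finset.filter_subset _ _))
  rw [pullback_apply_of_injOn f hs hf subset_rfl
      (cup_apply_of_notMem oL (empty_notMem_faces L) i x y),
    cup_apply oL (f.map_faces s hs), cup_apply o hs, cutSets_image hf, Finset.sum_image hinj]
  refine Finset.sum_congr rfl fun T hT => ?_
  have hTs := (mem_cutSets.1 hT).1
  rw [pullback_apply_of_injOn f hs hf (o.leftPart_subset T s) hx,
    pullback_apply_of_injOn f hs hf (o.rightPart_subset T s) hy,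
    f.leftPart_image hs hf hTs, f.rightPart_image hs hf hTs]

theorem VertexOrder.below_of_adjacent (o : VertexOrder K) {T : Finset V} {a b : V}
    (hadj : ∀ t ∈ T, o.order.lt t b ↔ o.order.le t a) :
    o.below T b = o.below T a + if a ∈ T then 1 else 0 := by
  let _ := o.order
  have hle : T.filter (fun t => o.order.lt t b) = T.filter fun t => o.order.le t a :=
    Finset.filter_congr hadj
  unfold VertexOrder.below
  rw [hle]
  split_ifs with ha
  · have hinsert : T.filter (fun t => o.order.le t a) =
        insert a (T.filter fun t => o.order.lt t a) := by
      ext t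
      rw [Finset.mem_insert, Finset.mem_filter, Finset.mem_filter, le_iff_eq_or_lt]
      constructor
      · rintro ⟨ht, rfl | hlt⟩
        exacts [Or.inl rfl, Or.inr ⟨ht, hlt⟩]
      · rintro (rfl | ⟨ht, hlt⟩)
        exacts [⟨ha, Or.inl rfl⟩, ⟨ht, Or.inr hlt⟩]
    have hnot : a ∉ T.filter fun t => o.order.lt t a := fun h =>
      lt_irrefl a (Finset.mem_filter.1 h).2
    rw [hinsert, Finset.card_insert_of_notMem hnot]
  · refine congrArg _ (Finset.filter_congr fun t ht => ?_)
    exact ⟨fun h => lt_of_le_of_ne h fun hta => ha (hta ▸ ht), le_of_lt⟩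

theorem VertexOrder.mem_leftPart_or_mem_rightPart_of_adjacent (o : VertexOrder K)
    {s T : Finset V} (hT : T ⊆ s) {a b : V} (ha : a ∈ s) (hb : b ∈ s)
    (hadj : ∀ t ∈ s, o.order.lt t b ↔ o.order.le t a) :
    (a ∈ o.leftPart T s ∧ b ∈ o.leftPart T s) ∨ (a ∈ o.rightPart T s ∧ b ∈ o.rightPart T s) := by
  simp only [o.mem_leftPart, o.mem_rightPart, ha, hb, true_and,
    o.below_of_adjacent fun t ht => hadj t (hT ht)]
  by_cases haT : a ∈ T
  · simp only [haT, if_true, Nat.even_add_one, Nat.odd_add_one, Nat.not_odd_iff_even]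
    have := Nat.even_or_odd (o.below T a)
    tauto
  · simp only [haT, if_false, add_zero]
    have := Nat.even_or_odd (o.below T a)
    tauto

theorem OrderedMap.exists_lt_of_not_injOn (f : OrderedMap o A oL B) {s : Finset V}
    (hs : s ∈ K.faces) (hf : ¬ Set.InjOn f.toFun s) :
    ∃ a ∈ s, ∃ c ∈ s, o.order.lt a c ∧ f.toFun a = f.toFun c := by
  simp only [Set.InjOn, not_forall, Finset.mem_coe] at hf
  obtain ⟨a, ha, c, hc, hac, hne⟩ := hf
  rcases o.lt_or_lt hs ha hc hne with h | h
  · exact ⟨a, ha, c, hc, h, hac⟩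
  · exact ⟨c, hc, a, ha, h, hac.symm⟩

theorem OrderedMap.exists_adjacent (f : OrderedMap o A oL B) {s : Finset V} (hs : s ∈ K.faces)
    (hf : ¬ Set.InjOn f.toFun s) : ∃ a ∈ s, ∃ b ∈ s, a ≠ b ∧ f.toFun a = f.toFun b ∧
      ∀ t ∈ s, o.order.lt t b ↔ o.order.le t a := by
  let _ := o.order
  let _ := oL.order
  have hface : ∀ u ∈ s, ({u} : Finset V) ∈ K.faces := fun u hu =>
    (K.isRelLowerSet_faces hs).2 (Finset.singleton_subset_iff.2 hu) (Finset.singleton_nonempty u)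
  obtain ⟨a, ha, c, hc, hac, hfac⟩ := f.exists_lt_of_not_injOn hs hf
  obtain ⟨b, hb, hbmin⟩ := (s.filter fun w => o.order.lt a w).exists_minimal
    ⟨c, Finset.mem_filter.2 ⟨hc, hac⟩⟩
  obtain ⟨hbs, hab⟩ := Finset.mem_filter.1 hb
  have hmin : ∀ t ∈ s, o.order.lt a t → o.order.le b t := fun t ht hat =>
    (o.total s hs b hbs t ht).elim id (hbmin (Finset.mem_filter.2 ⟨ht, hat⟩))
  refine ⟨a, ha, b, hbs, hab.ne, le_antisymm ?_ ?_, fun t ht => ⟨fun h => ?_, fun h => ?_⟩⟩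
  · exact f.mono a b (hface a ha) (hface b hbs) hab.le
  · rw [hfac]
    exact f.mono b c (hface b hbs) (hface c hc) (hmin c hc hac)
  · refine (o.total s hs t ht a ha).elim id fun hat => ?_
    by_contra hta
    exact (lt_of_lt_of_le h (hmin t ht (lt_of_le_not_ge hat hta))).false
  · exact lt_of_le_of_lt h hab

theorem cup_pullback_apply_of_not_injOn (f : OrderedMap o A oL B) (i : ℤ)
    (x y : Finset W → ZMod 2) {s : Finset V} (hs : s ∈ K.faces) (hf : ¬ Set.InjOn f.toFun s) :
    cup o i (pullback f x) (pullback f y) s = 0 := by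
  obtain ⟨a, ha, b, hb, hne, hab, hadj⟩ := f.exists_adjacent hs hf
  have hdeg : ∀ (z : Finset W → ZMod 2) (t : Finset V), a ∈ t → b ∈ t → pullback f z t = 0 :=
    fun z t hat hbt => if_neg fun h => hne (h.2 hat hbt hab)
  rw [cup_apply o hs]
  refine Finset.sum_eq_zero fun T hT => ?_
  rcases o.mem_leftPart_or_mem_rightPart_of_adjacent (mem_cutSets.1 hT).1 ha hb hadj with h | h
  · rw [hdeg x _ h.1 h.2, zero_mul]
  · rw [hdeg y _ h.1 h.2, mul_zero]

theorem pullback_cup (f : OrderedMap o A oL B) (i : ℤ) {x y : Finset W → ZMod 2}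
    (hx : x ∅ = 0) (hy : y ∅ = 0) :
    pullback f (cup oL i x y) = cup o i (pullback f x) (pullback f y) := by
  funext s
  by_cases hs : s ∈ K.faces
  · by_cases hf : Set.InjOn f.toFun s
    · exact pullback_cup_apply_of_injOn f i hx hy hs hf
    · rw [cup_pullback_apply_of_not_injOn f i x y hs hf]
      exact if_neg fun h => hf h.2
  · rw [cup_apply_of_notMem o hs]
    exact if_neg fun h => hs h.1

end CupProducts

/-! ### Integration -/

section Integration

variable {K A : PreAbstractSimplicialComplex V} {n : ℕ}

/-- The mod 2 fundamental chain, the sum of all `n`-simplices. -/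
noncomputable def fundamentalChain (hK : K.faces.Finite) (n : ℕ) : Chains V :=
  ∑ s ∈ hK.toFinset with s.card = n + 1, simplex s

theorem integral_eq_evalChain (hK : K.faces.Finite) (n : ℕ) (w : Finset V → ZMod 2) :
    integral K n w = evalChain w (fundamentalChain hK n) := by
  simp only [fundamentalChain, map_sum, evalChain_simplex]
  refine finsum_mem_eq_sum_of_inter_support_eq _ ?_
  simp only [Finset.coe_filter, Set.Finite.mem_toFinset]

theorem fundamentalChain_mem_chainsOn (hK : K.faces.Finite) (n : ℕ) :
    fundamentalChain hK n ∈ chainsOn {s ∈ K.faces | s.card = n + 1} := by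
  refine Submodule.sum_mem _ fun s hs => simplex_mem_chainsOn ?_
  rwa [Finset.mem_filter, hK.mem_toFinset] at hs

theorem fundamentalChain_apply (hK : K.faces.Finite) {s : Finset V} (hs : s ∈ K.faces)
    (hcard : s.card = n + 1) : fundamentalChain hK n s = 1 := by
  rw [fundamentalChain, Finsupp.finsetSum_apply, Finset.sum_eq_single_of_mem s,
    Finsupp.single_eq_same]
  · exact Finset.mem_filter.2 ⟨hK.mem_toFinset.2 hs, hcard⟩
  · exact fun t _ hts => Finsupp.single_eq_of_ne hts.symm

theorem integral_add (hK : K.faces.Finite) (n : ℕ) (w w' : Finset V → ZMod 2) :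
    integral K n (w + w') = integral K n w + integral K n w' := by
  simp only [integral_eq_evalChain hK, map_add, LinearMap.add_apply]

theorem finite_sd_faces (hK : K.faces.Finite) : (sd K).faces.Finite :=
  have : Finite {s : Finset V // s ∈ K.faces} := hK.to_subtype
  Set.toFinite _

theorem sdChain_fundamentalChain_mem (hK : K.faces.Finite) (n : ℕ) :
    sdChain K (fundamentalChain hK n) ∈ chainsOn {F ∈ (sd K).faces | F.card = n + 1} := by
  suffices h : chainsOn {s ∈ K.faces | s.card = n + 1} ≤
      (chainsOn {F ∈ (sd K).faces | F.card = n + 1}).comap (sdChain K) from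
    h (fundamentalChain_mem_chainsOn hK n)
  refine chainsOn_le fun s hs => ?_
  refine Finsupp.supported_mono (fun F hF => ?_) (sdChain_simplex_mem_flags (Or.inr hs.1))
  have hcard : F.card = n + 1 := hF.2.1.trans hs.2
  exact ⟨⟨Finset.card_pos.1 (hcard ▸ n.succ_pos), hF.1, fun g _ => g.2⟩, hcard⟩

theorem sdChain_fundamentalChain_apply (hK : K.faces.Finite)
    (hdim : ∀ s ∈ K.faces, s.card ≤ n + 1) {F : Finset {s : Finset V // s ∈ K.faces}}
    (hF : F ∈ (sd K).faces) (hcard : F.card = n + 1) :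
    sdChain K (fundamentalChain hK n) F = 1 := by
  obtain ⟨hne, hchain, -⟩ := hF
  obtain ⟨t, ht, htop⟩ := exists_isGreatest_of_isChain hchain hne
  have htcard : t.1.card = n + 1 :=
    (hdim t.1 t.2).antisymm (hcard ▸ card_le_card_of_isChain hchain htop)
  have happly : ∀ s ∈ K.faces, s.card = n + 1 →
      sdChain K (simplex s) F = if ∀ g ∈ F, g.1 ⊆ s then 1 else 0 := fun s hs hscard =>
    sdChain_simplex_apply (Or.inr hs) hchain (hcard.trans hscard.symm)
  rw [fundamentalChain, map_sum, Finsupp.finsetSum_apply, Finset.sum_eq_single_of_mem t.1]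
  · rw [happly t.1 t.2 htcard]
    exact if_pos htop
  · exact Finset.mem_filter.2 ⟨hK.mem_toFinset.2 t.2, htcard⟩
  · intro s hs hst
    rw [Finset.mem_filter, hK.mem_toFinset] at hs
    rw [happly s hs.1 hs.2]
    refine if_neg fun h => hst ?_
    exact (Finset.eq_of_subset_of_card_le (h t ht) (by rw [htcard, hs.2])).symm

theorem sdChain_fundamentalChain (hK : K.faces.Finite) (hdim : ∀ s ∈ K.faces, s.card ≤ n + 1) :
    sdChain K (fundamentalChain hK n) = fundamentalChain (finite_sd_faces hK) n := by
  refine Finsupp.ext fun F => ?_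
  by_cases hF : F ∈ (sd K).faces ∧ F.card = n + 1
  · rw [sdChain_fundamentalChain_apply hK hdim hF.1 hF.2, fundamentalChain_apply _ hF.1 hF.2]
  · rw [(Finsupp.mem_supported' _ _).1 (sdChain_fundamentalChain_mem hK n) F hF,
      (Finsupp.mem_supported' _ _).1 (fundamentalChain_mem_chainsOn _ n) F hF]

theorem integral_sd (hK : K.faces.Finite) (hdim : ∀ s ∈ K.faces, s.card ≤ n + 1)
    {x : Finset {s : Finset V // s ∈ K.faces} → ZMod 2} (hx : x ∅ = 0) :
    integral (sd K) n x = integral K n (sdCochain K x) := by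
  have hmem : fundamentalChain hK n ∈ chainsOn (insert ∅ K.faces) :=
    Finsupp.supported_mono (fun _ hs => Or.inr hs.1) (fundamentalChain_mem_chainsOn hK n)
  rw [integral_eq_evalChain (finite_sd_faces hK), integral_eq_evalChain hK, sdCochain,
    evalChain_dualMap (by rw [sdChain_simplex_empty, evalChain_simplex, hx]) hmem,
    sdChain_fundamentalChain hK hdim]

/-- The sum of the `n`-simplices of the finite complex `K` of dimension at most `n` is a cycle
relative to `A`: an `(n - 1)`-simplex outside `A` is a facet of an even number of simplices. -/
structure IsRelativeCycle (K A : PreAbstractSimplicialComplex V) (n : ℕ) : Prop where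
  finite : K.faces.Finite
  card_le : ∀ s ∈ K.faces, s.card ≤ n + 1
  even_cofaces : ∀ r ∈ K.faces, r ∉ A.faces → r.card = n → Even {s ∈ K.faces | r ⋖ s}.ncard

theorem IsRelativeCycle.chainBoundary_apply (h : IsRelativeCycle K A n) {r : Finset V}
    (hr : r ∈ K.faces) (hA : r ∉ A.faces) (hcard : r.card = n) :
    chainBoundary V (fundamentalChain h.finite n) r = 0 := by
  have hcofaces : {s ∈ K.faces | r ⋖ s} =
      ((h.finite.toFinset.filter fun s => s.card = n + 1).filter fun s => r ⋖ s : Finset _) := by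
    ext s
    simp only [Finset.coe_filter, Finset.mem_filter, h.finite.mem_toFinset]
    refine ⟨fun hs => ⟨⟨hs.1, ?_⟩, hs.2⟩, fun hs => ⟨hs.1.1, hs.2⟩⟩
    rw [← hcard]
    exact (Order.covBy_iff_add_one_eq.1 hs.2.card_finset).symm
  have heven := h.even_cofaces r hr hA hcard
  rw [hcofaces, Set.ncard_coe_finset] at heven
  simp only [fundamentalChain, map_sum, Finsupp.finsetSum_apply, chainBoundary_simplex_apply]
  rwa [Finset.sum_boole, ZMod.natCast_eq_zero_iff_even]

theorem IsRelativeCycle.integral_coboundary (h : IsRelativeCycle K A n) {w : Finset V → ZMod 2}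
    (hw : w ∈ relCochains K A ((n : ℤ) - 1)) : integral K n (coboundary K w) = 0 := by
  have hmem : fundamentalChain h.finite n ∈ chainsOn (insert ∅ K.faces) :=
    Finsupp.supported_mono (fun _ hs => Or.inr hs.1) (fundamentalChain_mem_chainsOn _ n)
  have hboundary : chainBoundary V (fundamentalChain h.finite n) ∈ chainsOn {r | w r = 0} := by
    refine (Finsupp.mem_supported' _ _).2 fun r hr => ?_
    obtain ⟨hrK, hrA, hcard⟩ := of_mem_relCochains hw hr
    exact h.chainBoundary_apply hrK hrA (by omega)
  rw [integral_eq_evalChain h.finite, coboundary_eq_dualMap,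
    evalChain_dualMap (by rw [chainBoundary_simplex_empty, map_zero]) hmem]
  exact evalChain_eq_zero (fun _ => id) hboundary

theorem IsRelativeCycle.integral_sd_coboundary (h : IsRelativeCycle K A n)
    {w : Finset {s : Finset V // s ∈ K.faces} → ZMod 2}
    (hw : w ∈ relCochains (sd K) (sdSub K A) ((n : ℤ) - 1)) :
    integral (sd K) n (coboundary (sd K) w) = 0 := by
  rw [integral_sd h.finite h.card_le (coboundary_apply_of_notMem (empty_notMem_faces _) w),
    ← coboundary_sdCochain (relCochains_empty hw), h.integral_coboundary (sdCochain_mem hw)]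

theorem IsRelativeCycle.integral_pullback (h : IsRelativeCycle K A n) (o : VertexOrder K)
    {k : ℤ} {w : Finset V → ZMod 2} (hw : w ∈ relCochains K A k) :
    integral (sd K) n (pullback (barycentricMap o A) w) = integral K n w := by
  rw [integral_sd h.finite h.card_le (relCochains_empty (pullback_mem _ hw)),
    sdCochain_pullback o hw]

end Integration

/-! ### Manifolds -/

section Manifolds

variable {X : PreAbstractSimplicialComplex V}

theorem augChains_eq_bot {k : ℤ} (h : ∀ s, (s ∈ X.faces ∨ s = ∅) → (s.card : ℤ) ≠ k + 1) :
    augChains X k = ⊥ := by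
  have hempty : {s : Finset V | (s ∈ X.faces ∨ s = ∅) ∧ (s.card : ℤ) = k + 1} = ∅ :=
    Set.eq_empty_iff_forall_notMem.2 fun s hs => h s hs.1 hs.2
  rw [augChains, hempty, Finsupp.supported_empty]

theorem card_le_of_isHomologySphere_link {K : PreAbstractSimplicialComplex V} {n : ℕ}
    {s : Finset V} (h : IsHomologySphere (link K s) ((n : ℤ) - s.card)) : s.card ≤ n + 1 := by
  by_contra hlt
  have hcycles : Subsingleton (augCycles (link K s) ((n : ℤ) - s.card)) := by
    rw [augCycles, augChains_eq_bot fun t _ => by omega, bot_inf_eq]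
    infer_instance
  have hhomology : Subsingleton (ReducedHomology (link K s) ((n : ℤ) - s.card)) :=
    (Submodule.mkQ_surjective _).subsingleton
  obtain ⟨e⟩ := h.1
  exact not_subsingleton (ZMod 2) e.symm.toEquiv.subsingleton

theorem IsAcyclic.faces_nonempty (h : IsAcyclic X) : X.faces.Nonempty := by
  by_contra hX
  rw [Set.not_nonempty_iff_eq_empty] at hX
  have hcycle : simplex ∅ ∈ augCycles X (-1) :=
    ⟨simplex_mem_chainsOn ⟨Or.inr rfl, by simp⟩, chainBoundary_simplex_empty⟩
  have hchains : augChains X (-1 + 1) = ⊥ := augChains_eq_bot fun t ht => by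
    rw [hX] at ht
    rw [ht.resolve_left (Set.notMem_empty t)]
    simp
  have := h (-1)
  have hclass : (Submodule.Quotient.mk ⟨simplex ∅, hcycle⟩ : ReducedHomology X (-1)) = 0 :=
    Subsingleton.elim _ _
  rw [Submodule.Quotient.mk_eq_zero, hchains, Submodule.map_bot, Submodule.mem_comap,
    Submodule.mem_bot] at hclass
  exact one_ne_zero (Finsupp.single_eq_zero.1 hclass)

theorem exists_unique_ne_zero_augCycles {k : ℤ} (hX : augChains X (k + 1) = ⊥)
    (h : Nonempty (ReducedHomology X k ≃ₗ[ZMod 2] ZMod 2)) :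
    ∃ z ∈ augCycles X k, z ≠ 0 ∧ ∀ y ∈ augCycles X k, y ≠ 0 → y = z := by
  obtain ⟨e⟩ := h
  let e' : augCycles X k ≃ₗ[ZMod 2] ZMod 2 :=
    (Submodule.quotEquivOfEqBot _ (by simp [hX])).symm.trans e
  have hne : e'.symm 1 ≠ 0 := (map_ne_zero_iff _ e'.symm.injective).2 one_ne_zero
  refine ⟨e'.symm 1, (e'.symm 1).2, Submodule.coe_eq_zero.not.2 hne, fun y hy hy0 => ?_⟩
  have hone : ∀ a : ZMod 2, a ≠ 0 → a = 1 := by decide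
  have hy1 : e' ⟨y, hy⟩ = 1 := hone _ ((map_ne_zero_iff _ e'.injective).2 fun h =>
    hy0 (congrArg Subtype.val h))
  exact congrArg Subtype.val (e'.eq_symm_apply.2 hy1)

theorem chainBoundary_simplex_of_card_eq_one {s : Finset V} (hs : s.card = 1) :
    chainBoundary V (simplex s) = simplex ∅ := by
  obtain ⟨v, rfl⟩ := Finset.card_eq_one.1 hs
  rw [chainBoundary_simplex, Finset.sum_singleton, Finset.erase_singleton]

theorem chainBoundary_apply_empty {x : Chains V} (hx : ∀ s ∈ x.support, s.card = 1) :
    chainBoundary V x ∅ = x.support.card := by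
  have hone : ∀ a : ZMod 2, a ≠ 0 → a = 1 := by decide
  have hsum : x = ∑ s ∈ x.support, simplex s := by
    conv_lhs => rw [← x.sum_single]
    exact Finset.sum_congr rfl fun s hs => by rw [hone _ (Finsupp.mem_support_iff.1 hs)]
  conv_lhs => rw [hsum]
  rw [map_sum, Finsupp.finsetSum_apply, Finset.sum_congr rfl fun s hs => by
    rw [chainBoundary_simplex_of_card_eq_one (hx s hs), Finsupp.single_eq_same],
    Finset.sum_const, nsmul_one]

theorem simplex_add_simplex_mem_augCycles {s t : Finset V} (hs : s ∈ X.faces) (hs1 : s.card = 1)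
    (ht : t ∈ X.faces) (ht1 : t.card = 1) : simplex s + simplex t ∈ augCycles X 0 := by
  refine ⟨add_mem (simplex_mem_chainsOn ⟨Or.inl hs, by simp [hs1]⟩)
    (simplex_mem_chainsOn ⟨Or.inl ht, by simp [ht1]⟩), ?_⟩
  rw [SetLike.mem_coe, LinearMap.mem_ker, map_add, chainBoundary_simplex_of_card_eq_one hs1,
    chainBoundary_simplex_of_card_eq_one ht1, ZModModule.add_self]

-- The sum of two distinct vertices is a nonzero cycle, so it is equal to `z`.
theorem support_eq_vertices {z : Chains V} (hz : z ∈ augCycles X 0) (hz0 : z ≠ 0)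
    (hunique : ∀ y ∈ augCycles X 0, y ≠ 0 → y = z) :
    {s ∈ X.faces | s.card = 1} = (z.support : Set (Finset V)) := by
  have hvertex : ∀ t ∈ z.support, t ∈ X.faces ∧ t.card = 1 := fun t ht => by
    obtain ⟨htX, htcard⟩ := hz.1 ht
    have ht1 : t.card = 1 := by omega
    exact ⟨htX.resolve_right fun h => by simp [h] at ht1, ht1⟩
  refine Set.Subset.antisymm (fun s hs => ?_) hvertex
  by_contra hsz
  obtain ⟨t, ht⟩ := Finsupp.support_nonempty_iff.2 hz0
  have hst : s ≠ t := fun h => hsz (h ▸ ht)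
  have hne : (simplex s + simplex t) s ≠ 0 := by
    rw [Finsupp.add_apply, Finsupp.single_eq_same, Finsupp.single_eq_of_ne hst, add_zero]
    exact one_ne_zero
  have heq : simplex s + simplex t = z :=
    hunique _ (simplex_add_simplex_mem_augCycles hs.1 hs.2 (hvertex t ht).1 (hvertex t ht).2)
      fun h => hne (h ▸ rfl)
  exact hsz (Finsupp.mem_support_iff.2 (heq ▸ hne))

theorem even_ncard_vertices (hX : augChains X 1 = ⊥)
    (h : Nonempty (ReducedHomology X 0 ≃ₗ[ZMod 2] ZMod 2)) :
    Even {s ∈ X.faces | s.card = 1}.ncard := by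
  obtain ⟨z, hz, hz0, hunique⟩ := exists_unique_ne_zero_augCycles (k := 0) hX h
  have hsupport := support_eq_vertices hz hz0 hunique
  have hcard : ∀ s ∈ z.support, s.card = 1 := fun s hs => (hsupport.ge hs).2
  rw [hsupport, Set.ncard_coe_finset, ← ZMod.natCast_eq_zero_iff_even,
    ← chainBoundary_apply_empty hcard, LinearMap.mem_ker.1 hz.2, Finsupp.zero_apply]

theorem ncard_cofaces_eq_ncard_vertices_link (K : PreAbstractSimplicialComplex V) (r : Finset V) :
    {s ∈ K.faces | r ⋖ s}.ncard = {t ∈ (link K r).faces | t.card = 1}.ncard := by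
  refine (Set.ncard_congr (fun t _ => t ∪ r) ?_ ?_ ?_).symm
  · rintro t ⟨⟨-, hdisj, hK⟩, hcard⟩
    obtain ⟨v, rfl⟩ := Finset.card_eq_one.1 hcard
    exact ⟨hK, Finset.covBy_insert (Finset.disjoint_singleton_left.1 hdisj)⟩
  · rintro t t' ⟨⟨-, hdisj, -⟩, -⟩ ⟨⟨-, hdisj', -⟩, -⟩ heq
    rw [← Finset.union_sdiff_cancel_right hdisj, heq, Finset.union_sdiff_cancel_right hdisj']
  · rintro s ⟨hK, hs⟩
    obtain ⟨v, hv, rfl⟩ := Finset.covBy_iff_exists_insert.1 hs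
    exact ⟨{v}, ⟨⟨Finset.singleton_nonempty v, Finset.disjoint_singleton_left.2 hv, hK⟩,
      Finset.card_singleton v⟩, rfl⟩

theorem IsTriangulatedManifold.notMem_boundary_of_maximal {K A : PreAbstractSimplicialComplex V}
    {n : ℕ} (hM : IsTriangulatedManifold K A n) {s : Finset V} (hs : Maximal (· ∈ K.faces) s) :
    s ∉ A.faces := fun hA => by
  obtain ⟨t, ⟨v, hv⟩, hdisj, hK⟩ := (hM.link_boundary s hA).faces_nonempty
  exact Finset.disjoint_left.1 hdisj hv
    (hs.2 hK Finset.subset_union_right (Finset.mem_union_left s hv))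

theorem IsTriangulatedManifold.card_le {K A : PreAbstractSimplicialComplex V} {n : ℕ}
    (hM : IsTriangulatedManifold K A n) {s : Finset V} (hs : s ∈ K.faces) : s.card ≤ n + 1 := by
  obtain ⟨t, hst, ht⟩ := hM.finite.exists_le_maximal hs
  exact (Finset.card_le_card hst).trans (card_le_of_isHomologySphere_link
    (hM.link_interior t ht.1 (hM.notMem_boundary_of_maximal ht)))

theorem IsTriangulatedManifold.isRelativeCycle {K A : PreAbstractSimplicialComplex V} {n : ℕ}
    (hM : IsTriangulatedManifold K A n) : IsRelativeCycle K A n where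
  finite := hM.finite
  card_le _ := hM.card_le
  even_cofaces r hr hA hcard := by
    have hsphere := (hM.link_interior r hr hA).1
    rw [hcard, sub_self] at hsphere
    rw [ncard_cofaces_eq_ncard_vertices_link]
    refine even_ncard_vertices (augChains_eq_bot ?_) hsphere
    rintro t (⟨-, hdisj, hK⟩ | rfl) ht
    · have := hM.card_le hK
      rw [Finset.card_union_of_disjoint hdisj] at this
      omega
    · simp at ht

end Manifolds

/-! ### Integrals of products -/

section ProductIntegrals

variable {K A : PreAbstractSimplicialComplex V} {n : ℕ}

theorem coboundary_mem {k : ℤ} {c : Finset V → ZMod 2} (hc : c ∈ relCochains K A k) :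
    coboundary K c ∈ relCochains K A (k + 1) := by
  intro s hs
  by_contra hne
  have hK : s ∈ K.faces := by
    by_contra hK
    exact hne (coboundary_apply_of_notMem hK c)
  rw [coboundary_apply hK] at hne
  obtain ⟨v, hv, hcv⟩ := Finset.exists_ne_zero_of_sum_ne_zero hne
  obtain ⟨hvK, hvA, hcard⟩ := of_mem_relCochains hc hcv
  refine hs ⟨hK, fun hA => hvA ?_, ?_⟩
  · exact (A.isRelLowerSet_faces hA).2 (Finset.erase_subset v s) (K.isRelLowerSet_faces hvK).1
  · rw [← Finset.card_erase_add_one hv]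
    push_cast
    omega

/-- Stokes' theorem holds for the sum of the `n`-simplices of the finite complex `K`: relative
coboundaries integrate to zero. -/
structure HasFundamentalClass (K A : PreAbstractSimplicialComplex V) (n : ℕ) : Prop where
  finite : K.faces.Finite
  integral_coboundary : ∀ w ∈ relCochains K A ((n : ℤ) - 1), integral K n (coboundary K w) = 0

theorem integral_zero (K : PreAbstractSimplicialComplex V) (n : ℕ) : integral K n 0 = 0 := by
  simp [integral]

variable (h : HasFundamentalClass K A n) (o : VertexOrder K)

include h

theorem HasFundamentalClass.integral_coboundary_cup {k l i : ℤ} (hkl : k + l - i = n - 1)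
    {x y : Finset V → ZMod 2} (hx : x ∈ relCochains K A k) (hy : y ∈ relCochains K A l) :
    integral K n (cup o i (coboundary K x) y) + integral K n (cup o i x (coboundary K y)) +
      integral K n (cup o (i - 1) x y) + integral K n (cup o (i - 1) y x) = 0 := by
  have hstokes := h.integral_coboundary _ (hkl ▸ cup_mem (o := o) (i := i) hx hy)
  rwa [coboundary_cup o i (relCochains_empty hx), integral_add h.finite, integral_add h.finite,
    integral_add h.finite] at hstokes

theorem HasFundamentalClass.integral_cup_comm {p q : Finset V → ZMod 2}
    (hp : p ∈ relCocycles K A ((n : ℤ) - 1)) (hq : q ∈ relCocycles K A ((n : ℤ) - 1)) :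
    integral K n (cup o ((n : ℤ) - 2) p q) = integral K n (cup o ((n : ℤ) - 2) q p) := by
  have hstokes := h.integral_coboundary_cup o (i := (n : ℤ) - 1) (by ring) hp.1 hq.1
  rw [LinearMap.mem_ker.1 hp.2, LinearMap.mem_ker.1 hq.2, cup_zero_left, cup_zero_right,
    integral_zero, add_zero, zero_add, sub_sub, one_add_one_eq_two] at hstokes
  exact CharTwo.add_eq_zero.1 hstokes

theorem HasFundamentalClass.integral_sq_add {c e : Finset V → ZMod 2}
    (hc : c ∈ relCochains K A ((n : ℤ) - 2)) (he : e ∈ relCochains K A ((n : ℤ) - 2)) :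
    integral K n (sq o 2 ((n : ℤ) - 2) (c + e)) =
      integral K n (sq o 2 ((n : ℤ) - 2) c) + integral K n (sq o 2 ((n : ℤ) - 2) e) +
        integral K n (cup o ((n : ℤ) - 2) (coboundary K c) (coboundary K e)) := by
  have hce := h.integral_coboundary_cup o (i := (n : ℤ) - 2 - 2 + 1) (by ring) hc he
  have hdce := h.integral_coboundary_cup o (i := (n : ℤ) - 2) (by ring) (coboundary_mem hc) he
  rw [add_sub_cancel_right] at hce
  rw [coboundary_coboundary, cup_zero_left, integral_zero, zero_add,
    show (n : ℤ) - 2 - 1 = n - 2 - 2 + 1 by ring] at hdce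
  simp only [sq, map_add, cup_add_left, cup_add_right, integral_add h.finite]
  linear_combination hce + hdce -
    CharTwo.add_self_eq_zero
      (integral K n (cup o ((n : ℤ) - 2) (coboundary K c) (coboundary K e))) -
    CharTwo.add_self_eq_zero (integral K n (cup o ((n : ℤ) - 2 - 2 + 1) (coboundary K c) e))

theorem HasFundamentalClass.integral_sq_coboundary {e : Finset V → ZMod 2}
    (he : e ∈ relCochains K A ((n : ℤ) - 2 - 1)) :
    integral K n (sq o 2 ((n : ℤ) - 2) (coboundary K e)) = 0 := by
  have hede := h.integral_coboundary_cup o (i := (n : ℤ) - 2 - 2) (by ring) he (coboundary_mem he)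
  have hee := h.integral_coboundary_cup o (i := (n : ℤ) - 2 - 2 - 1) (by ring) he he
  rw [coboundary_coboundary, cup_zero_right, integral_zero, add_zero] at hede
  rw [add_assoc, CharTwo.add_self_eq_zero, add_zero] at hee
  rw [sq, coboundary_coboundary, cup_zero_right, add_zero]
  linear_combination hede - hee

theorem HasFundamentalClass.integral_sq_add_coboundary {c e : Finset V → ZMod 2}
    (hc : c ∈ relCochains K A ((n : ℤ) - 2)) (he : e ∈ relCochains K A ((n : ℤ) - 2 - 1)) :
    integral K n (sq o 2 ((n : ℤ) - 2) (c + coboundary K e)) =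
      integral K n (sq o 2 ((n : ℤ) - 2) c) := by
  have hde := coboundary_mem he
  rw [sub_add_cancel] at hde
  rw [h.integral_sq_add o hc hde, h.integral_sq_coboundary o he, coboundary_coboundary,
    cup_zero_right, integral_zero, add_zero, add_zero]

theorem HasFundamentalClass.integral_cup_coboundary_self {c : Finset V → ZMod 2}
    (hc : c ∈ relCochains K A ((n : ℤ) - 2)) :
    integral K n (cup o ((n : ℤ) - 2) (coboundary K c) (coboundary K c)) = 0 := by
  have hcc := h.integral_sq_add o hc hc
  rwa [CharTwo.add_self_eq_zero, CharTwo.add_self_eq_zero, zero_add, sq, cup_zero_left,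
    cup_zero_left, add_zero, integral_zero, eq_comm] at hcc

end ProductIntegrals

/-! ### Quadratic functions under order preserving maps -/

section QuadraticFunctions

variable {K A : PreAbstractSimplicialComplex V} {L B : PreAbstractSimplicialComplex W}
  {oK : VertexOrder K} {oL : VertexOrder L} {n : ℕ}

/-- `f` induces a surjection on relative cohomology in degree `k`. -/
def OrderedMap.CohomologySurjective (f : OrderedMap oK A oL B) (k : ℤ) : Prop :=
  ∀ p ∈ relCocycles K A k, ∃ q ∈ relCocycles L B k, ∃ c ∈ relCochains K A (k - 1),
    p = pullback f q + coboundary K c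

/-- `f` induces an injection on relative cohomology in degree `k`. -/
def OrderedMap.CohomologyInjective (f : OrderedMap oK A oL B) (k : ℤ) : Prop :=
  ∀ q ∈ relCocycles L B k, ∀ c ∈ relCochains K A (k - 1), pullback f q = coboundary K c →
    ∃ e ∈ relCochains L B (k - 1), q = coboundary L e

/-- `f` preserves integrals of relative `n`-cochains. -/
def OrderedMap.PreservesIntegral (f : OrderedMap oK A oL B) (n : ℕ) : Prop :=
  ∀ w ∈ relCochains L B n, integral K n (pullback f w) = integral L n w

theorem pullback_add (f : OrderedMap oK A oL B) (x y : Finset W → ZMod 2) :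
    pullback f (x + y) = pullback f x + pullback f y := by
  simp only [pullback_eq_dualMap, map_add]

theorem pullbackCocycle_add (f : OrderedMap oK A oL B) {k : ℤ} (p q : relCocycles L B k) :
    pullbackCocycle f k (p + q) = pullbackCocycle f k p + pullbackCocycle f k q :=
  Subtype.ext (pullback_add f p.1 q.1)

theorem OrderedMap.PreservesIntegral.integral_cup {f : OrderedMap oK A oL B}
    (hf : f.PreservesIntegral n) {k l i : ℤ} (hkl : k + l - i = n) {x y : Finset W → ZMod 2}
    (hx : x ∈ relCochains L B k) (hy : y ∈ relCochains L B l) :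
    integral K n (cup oK i (pullback f x) (pullback f y)) = integral L n (cup oL i x y) := by
  rw [← pullback_cup f i (relCochains_empty hx) (relCochains_empty hy),
    hf _ (hkl ▸ cup_mem (o := oL) (i := i) hx hy)]

variable (hK : K.faces.Finite) (hL : L.faces.Finite) {f : OrderedMap oK A oL B}
  (hf : f.PreservesIntegral n)

include hK hL hf

theorem OrderedMap.PreservesIntegral.integral_sq {c : Finset W → ZMod 2}
    (hc : c ∈ relCochains L B ((n : ℤ) - 2)) :
    integral K n (sq oK 2 ((n : ℤ) - 2) (pullback f c)) =
      integral L n (sq oL 2 ((n : ℤ) - 2) c) := by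
  rw [sq, sq, integral_add hK, integral_add hL, pullback_coboundary f hc,
    hf.integral_cup (by ring) hc hc, hf.integral_cup (by ring) hc (coboundary_mem hc)]

theorem IsQuadratic.comp_pullbackCocycle {Q : relCocycles K A ((n : ℤ) - 1) → UnitAddCircle}
    (hQ : IsQuadratic oK A n Q) :
    IsQuadratic oL B n (Q ∘ pullbackCocycle f ((n : ℤ) - 1)) where
  add p q := by
    rw [Function.comp_apply, pullbackCocycle_add, hQ.add]
    congr 2
    exact hf.integral_cup (by ring) p.2.1 q.2.1
  coboundary c hc p hp := by
    rw [Function.comp_apply, hQ.coboundary (pullback f c) (pullback_mem f hc),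
      hf.integral_sq hK hL hc]
    rw [pullback_coboundary f hc, ← hp]
    rfl

omit hK hL hf

theorem IsQuadratic.apply_zero {Q : relCocycles K A ((n : ℤ) - 1) → UnitAddCircle}
    (hQ : IsQuadratic oK A n Q) : Q 0 = 0 := by
  have h := hQ.add 0 0
  rw [add_zero, ZeroMemClass.coe_zero, cup_zero_left, integral_zero, map_zero, add_zero] at h
  exact left_eq_add.1 h

theorem coboundary_mem_relCocycles {c : Finset V → ZMod 2}
    (hc : c ∈ relCochains K A ((n : ℤ) - 2)) :
    coboundary K c ∈ relCocycles K A ((n : ℤ) - 1) := by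
  refine ⟨?_, coboundary_coboundary c⟩
  rw [show (n : ℤ) - 1 = n - 2 + 1 by ring]
  exact coboundary_mem hc

/-- The value at `f^* q + dc` of the extension along `f^*` of a quadratic function `Q`. -/
noncomputable def extensionValue (f : OrderedMap oK A oL B)
    (Q : relCocycles L B ((n : ℤ) - 1) → UnitAddCircle) (q : relCocycles L B ((n : ℤ) - 1))
    (c : Finset V → ZMod 2) : UnitAddCircle :=
  Q q + ZMod.toAddCircle (integral K n (sq oK 2 ((n : ℤ) - 2) c) +
    integral K n (cup oK ((n : ℤ) - 2) (pullback f q.1) (coboundary K c)))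

theorem extensionValue_zero_left {Q : relCocycles L B ((n : ℤ) - 1) → UnitAddCircle} (hQ : Q 0 = 0)
    (f : OrderedMap oK A oL B) (c : Finset V → ZMod 2) :
    extensionValue f Q 0 c = ZMod.toAddCircle (integral K n (sq oK 2 ((n : ℤ) - 2) c)) := by
  rw [extensionValue, hQ, zero_add, ZeroMemClass.coe_zero, pullback_eq_dualMap, map_zero,
    cup_zero_left, integral_zero, add_zero]

theorem extensionValue_zero_right (f : OrderedMap oK A oL B)
    (Q : relCocycles L B ((n : ℤ) - 1) → UnitAddCircle) (q : relCocycles L B ((n : ℤ) - 1)) :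
    extensionValue f Q q 0 = Q q := by
  rw [extensionValue, sq, map_zero, cup_zero_right, cup_zero_right, cup_zero_right, integral_zero,
    add_zero, add_zero, integral_zero, map_zero, add_zero]

theorem OrderedMap.CohomologySurjective.exists_eq_add {f : OrderedMap oK A oL B}
    (hf : f.CohomologySurjective ((n : ℤ) - 1)) (p : relCocycles K A ((n : ℤ) - 1)) :
    ∃ q : relCocycles L B ((n : ℤ) - 1), ∃ c ∈ relCochains K A ((n : ℤ) - 2),
      p.1 = pullback f q.1 + coboundary K c := by
  obtain ⟨q, hq, c, hc, hp⟩ := hf p.1 p.2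
  rw [sub_sub, one_add_one_eq_two] at hc
  exact ⟨⟨q, hq⟩, c, hc, hp⟩

theorem IsQuadratic.eq_of_comp_pullbackCocycle_eq {f : OrderedMap oK A oL B}
    (hf : f.CohomologySurjective ((n : ℤ) - 1))
    {Q Q' : relCocycles K A ((n : ℤ) - 1) → UnitAddCircle} (hQ : IsQuadratic oK A n Q)
    (hQ' : IsQuadratic oK A n Q')
    (heq : Q ∘ pullbackCocycle f ((n : ℤ) - 1) = Q' ∘ pullbackCocycle f ((n : ℤ) - 1)) :
    Q = Q' := by
  funext p
  obtain ⟨q, c, hc, hp⟩ := hf.exists_eq_add p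
  obtain rfl : p = pullbackCocycle f _ q + ⟨_, coboundary_mem_relCocycles hc⟩ := Subtype.ext hp
  rw [hQ.add, hQ'.add, hQ.coboundary c hc ⟨_, _⟩ rfl, hQ'.coboundary c hc ⟨_, _⟩ rfl]
  exact congrArg (· + _ + _) (congrFun heq q)

variable (h : HasFundamentalClass K A n) {Q : relCocycles L B ((n : ℤ) - 1) → UnitAddCircle}
  (hQ : IsQuadratic oL B n Q)

include hf h hQ

theorem IsQuadratic.extensionValue_add (q q' : relCocycles L B ((n : ℤ) - 1))
    {c c' : Finset V → ZMod 2} (hc : c ∈ relCochains K A ((n : ℤ) - 2))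
    (hc' : c' ∈ relCochains K A ((n : ℤ) - 2)) :
    extensionValue f Q (q + q') (c + c') = extensionValue f Q q c + extensionValue f Q q' c' +
      ZMod.toAddCircle (integral K n (cup oK ((n : ℤ) - 2)
        (pullback f q.1 + QuadraticCocycles.coboundary K c)
        (pullback f q'.1 + QuadraticCocycles.coboundary K c'))) := by
  have hqq' := hf.integral_cup (by ring : _ - ((n : ℤ) - 2) = n) q.2.1 q'.2.1
  have hcomm := h.integral_cup_comm oK (coboundary_mem_relCocycles hc)
    (pullbackCocycle f _ q').2
  change integral K n (cup oK _ _ (pullback f q'.1)) =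
    integral K n (cup oK _ (pullback f q'.1) _) at hcomm
  have hsq := h.integral_sq_add oK hc hc'
  simp only [extensionValue, hQ.add, hsq, Submodule.coe_add, pullback_add, map_add, cup_add_left,
    cup_add_right, integral_add h.finite, hqq', hcomm]
  abel

omit hf h hQ

theorem exists_primitive_of_pullback_eq_coboundary {k : ℤ}
    (hsurj : f.CohomologySurjective (k - 1)) (hinj : f.CohomologyInjective k)
    {q : Finset W → ZMod 2} (hq : q ∈ relCocycles L B k) {c : Finset V → ZMod 2}
    (hc : c ∈ relCochains K A (k - 1)) (hqc : pullback f q = coboundary K c) :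
    ∃ e ∈ relCochains L B (k - 1), q = coboundary L e ∧
      ∃ g ∈ relCochains K A (k - 1 - 1), c = pullback f e + coboundary K g := by
  obtain ⟨e, he, rfl⟩ := hinj q hq c hc hqc
  have hcocycle : c + pullback f e ∈ relCocycles K A (k - 1) := by
    refine ⟨add_mem hc (pullback_mem f he), LinearMap.mem_ker.2 ?_⟩
    rw [map_add, ← hqc, pullback_coboundary f he, CharTwo.add_self_eq_zero]
  obtain ⟨z, hz, g, hg, hcg⟩ := hsurj _ hcocycle
  refine ⟨e + z, add_mem he hz.1, ?_, g, hg, ?_⟩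
  · rw [map_add, LinearMap.mem_ker.1 hz.2, add_zero]
  · rw [pullback_add, add_assoc, ← hcg, add_left_comm, CharTwo.add_self_eq_zero, add_zero]

variable (hL : L.faces.Finite) (hsurj : f.CohomologySurjective ((n : ℤ) - 2))
  (hinj : f.CohomologyInjective ((n : ℤ) - 1))

include hL hf h hsurj hinj hQ

theorem IsQuadratic.extensionValue_eq_zero {q : relCocycles L B ((n : ℤ) - 1)}
    {c : Finset V → ZMod 2} (hc : c ∈ relCochains K A ((n : ℤ) - 2))
    (hqc : pullback f q.1 = QuadraticCocycles.coboundary K c) : extensionValue f Q q c = 0 := by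
  have hdeg : (n : ℤ) - 1 - 1 = n - 2 := by ring
  obtain ⟨e, he, hqe, g, hg, rfl⟩ := exists_primitive_of_pullback_eq_coboundary
    (by rwa [hdeg]) hinj q.2 (by rwa [hdeg]) hqc
  rw [hdeg] at he hg
  rw [extensionValue, hqc, h.integral_cup_coboundary_self oK hc, add_zero,
    h.integral_sq_add_coboundary oK (pullback_mem f he) hg, hf.integral_sq h.finite hL he,
    hQ.coboundary e he q hqe, ← map_add, CharTwo.add_self_eq_zero, map_zero]

theorem IsQuadratic.extensionValue_congr {q q' : relCocycles L B ((n : ℤ) - 1)}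
    {c c' : Finset V → ZMod 2} (hc : c ∈ relCochains K A ((n : ℤ) - 2))
    (hc' : c' ∈ relCochains K A ((n : ℤ) - 2))
    (heq : pullback f q.1 + QuadraticCocycles.coboundary K c =
      pullback f q'.1 + QuadraticCocycles.coboundary K c') :
    extensionValue f Q q c = extensionValue f Q q' c' := by
  have hdiff : pullback f (q' + q).1 = QuadraticCocycles.coboundary K (c' + c) := by
    rw [Submodule.coe_add, pullback_add, map_add]
    linear_combination heq + CharTwo.add_self_eq_zero (pullback f q'.1) -
      CharTwo.add_self_eq_zero (QuadraticCocycles.coboundary K c)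
  have hadd := hQ.extensionValue_add hf h q' (q' + q) hc' (add_mem hc' hc)
  rwa [hQ.extensionValue_eq_zero hL hf h hsurj hinj (add_mem hc' hc) hdiff, hdiff,
    CharTwo.add_self_eq_zero, cup_zero_right, integral_zero, map_zero, add_zero, add_zero,
    ← add_assoc, ← add_assoc, CharTwo.add_self_eq_zero, ZModModule.add_self, zero_add,
    zero_add] at hadd

theorem IsQuadratic.exists_comp_pullbackCocycle_eq
    (hsurj' : f.CohomologySurjective ((n : ℤ) - 1)) :
    ∃ Q', IsQuadratic oK A n Q' ∧ Q' ∘ pullbackCocycle f ((n : ℤ) - 1) = Q := by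
  choose q c hc hqc using hsurj'.exists_eq_add
  have hvalue (p : relCocycles K A ((n : ℤ) - 1)) (q' c') (hc' : c' ∈ relCochains K A _)
      (hp : p.1 = pullback f q'.1 + QuadraticCocycles.coboundary K c') :
      extensionValue f Q (q p) (c p) = extensionValue f Q q' c' :=
    hQ.extensionValue_congr hL hf h hsurj hinj (hc p) hc' (hqc p ▸ hp)
  refine ⟨fun p => extensionValue f Q (q p) (c p), ⟨fun p p' => ?_, fun e he p hp => ?_⟩,
    funext fun r => ?_⟩
  · rw [hvalue (p + p') (q p + q p') (c p + c p') (add_mem (hc p) (hc p')),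
      hQ.extensionValue_add hf h _ _ (hc p) (hc p'), ← hqc, ← hqc]
    rw [Submodule.coe_add, Submodule.coe_add, pullback_add, map_add, hqc p, hqc p']
    exact add_add_add_comm _ _ _ _
  · rw [hvalue p 0 e he, extensionValue_zero_left hQ.apply_zero]
    rw [hp, ZeroMemClass.coe_zero, pullback_eq_dualMap, map_zero, zero_add]
  · rw [Function.comp_apply, hvalue _ r 0 (zero_mem _), extensionValue_zero_right]
    rw [map_zero, add_zero]
    rfl

omit hQ

theorem OrderedMap.bijOn_comp_pullbackCocycle (hsurj' : f.CohomologySurjective ((n : ℤ) - 1)) :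
    Set.BijOn (fun Q' => Q' ∘ pullbackCocycle f ((n : ℤ) - 1)) {Q' | IsQuadratic oK A n Q'}
      {Q | IsQuadratic oL B n Q} :=
  ⟨fun _ hQ' => hQ'.comp_pullbackCocycle h.finite hL hf,
    fun _ hQ _ hQ' heq => hQ.eq_of_comp_pullbackCocycle_eq hsurj' hQ' heq,
    fun _ hQ => hQ.exists_comp_pullbackCocycle_eq hL hf h hsurj hinj hsurj'⟩

end QuadraticFunctions

section BarycentricSubdivision

variable {K A : PreAbstractSimplicialComplex V} {n : ℕ}

theorem IsRelativeCycle.hasFundamentalClass_sd (h : IsRelativeCycle K A n) :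
    HasFundamentalClass (sd K) (sdSub K A) n where
  finite := finite_sd_faces h.finite
  integral_coboundary _ hw := h.integral_sd_coboundary hw

theorem cohomologySurjective_barycentricMap (o : VertexOrder K) (k : ℤ) :
    (barycentricMap o A).CohomologySurjective k := by
  intro p hp
  have hclosed := LinearMap.mem_ker.1 hp.2
  refine ⟨sdCochain K p, ⟨sdCochain_mem hp.1, LinearMap.mem_ker.2 ?_⟩, sdHomotopy o p,
    sdHomotopy_mem o ?_, ?_⟩
  · rw [coboundary_sdCochain (relCochains_empty hp.1), hclosed, map_zero]
  · rw [sub_add_cancel]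
    exact hp.1
  · rw [pullback_sdCochain o hp.1, hclosed, map_zero, add_zero, add_assoc,
      ZModModule.add_self, add_zero]

theorem cohomologyInjective_barycentricMap (o : VertexOrder K) (k : ℤ) :
    (barycentricMap o A).CohomologyInjective k := by
  intro q hq c hc hqc
  refine ⟨sdCochain K c, sdCochain_mem hc, ?_⟩
  rw [coboundary_sdCochain (relCochains_empty hc), ← hqc, sdCochain_pullback o hq.1]

theorem IsRelativeCycle.bijOn_comp_pullbackCocycle (h : IsRelativeCycle K A n)
    (o : VertexOrder K) :
    Set.BijOn (fun Q' => Q' ∘ pullbackCocycle (barycentricMap o A) ((n : ℤ) - 1))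
      {Q' | IsQuadratic (sdOrder K) (sdSub K A) n Q'} {Q | IsQuadratic o A n Q} :=
  OrderedMap.bijOn_comp_pullbackCocycle h.finite (fun _ hw => h.integral_pullback o hw)
    h.hasFundamentalClass_sd (cohomologySurjective_barycentricMap o _)
    (cohomologyInjective_barycentricMap o _) (cohomologySurjective_barycentricMap o _)

end BarycentricSubdivision

theorem existsUnique_equiv_of_bijOn {α β γ : Type*} {s : Set α} {p : β → Prop} {r : γ → Prop}
    {f : α → β} {g : α → γ} (hf : Set.BijOn f s {b | p b}) (hg : Set.BijOn g s {c | r c}) :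
    ∃! Φ : {b // p b} ≃ {c // r c}, ∀ a, a ∈ s → ∀ b, b.1 = f a → (Φ b).1 = g a := by
  refine ⟨(hf.equiv f).symm.trans (hg.equiv g), fun a ha b hb => ?_, fun Φ hΦ => ?_⟩
  · obtain rfl : hf.equiv f ⟨a, ha⟩ = b := Subtype.ext hb.symm
    exact congrArg (fun x => (hg.equiv g x).1) ((hf.equiv f).symm_apply_apply ⟨a, ha⟩)
  · refine Equiv.ext fun b => ?_
    obtain ⟨a, rfl⟩ := (hf.equiv f).surjective b
    refine Subtype.ext ((hΦ a a.2 _ rfl).trans ?_)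
    exact congrArg (fun x => (hg.equiv g x).1) ((hf.equiv f).symm_apply_apply a).symm

end QuadraticCocycles

theorem mainTheorem5_general {V : Type*} (K A : PreAbstractSimplicialComplex V) (n : ℕ)
    (h : QuadraticCocycles.IsRelativeCycle K A n) :
    (∀ o : QuadraticCocycles.VertexOrder K,
      Set.BijOn
        (fun Q' : QuadraticCocycles.relCocycles (QuadraticCocycles.sd K)
            (QuadraticCocycles.sdSub K A) ((n : ℤ) - 1) → UnitAddCircle =>
          Q' ∘ QuadraticCocycles.pullbackCocycle
            (QuadraticCocycles.barycentricMap o A) ((n : ℤ) - 1))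
        {Q' | QuadraticCocycles.IsQuadratic (QuadraticCocycles.sdOrder K)
          (QuadraticCocycles.sdSub K A) n Q'}
        {Q | QuadraticCocycles.IsQuadratic o A n Q}) ∧
    (∀ o₁ o₂ : QuadraticCocycles.VertexOrder K,
      ∃! Φ : {Q // QuadraticCocycles.IsQuadratic o₁ A n Q} ≃
          {Q // QuadraticCocycles.IsQuadratic o₂ A n Q},
        ∀ Q' : QuadraticCocycles.relCocycles (QuadraticCocycles.sd K)
            (QuadraticCocycles.sdSub K A) ((n : ℤ) - 1) → UnitAddCircle,
          QuadraticCocycles.IsQuadratic (QuadraticCocycles.sdOrder K)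
            (QuadraticCocycles.sdSub K A) n Q' →
          ∀ Q₁ : {Q // QuadraticCocycles.IsQuadratic o₁ A n Q},
            Q₁.1 = Q' ∘ QuadraticCocycles.pullbackCocycle
              (QuadraticCocycles.barycentricMap o₁ A) ((n : ℤ) - 1) →
            (Φ Q₁).1 = Q' ∘ QuadraticCocycles.pullbackCocycle
              (QuadraticCocycles.barycentricMap o₂ A) ((n : ℤ) - 1)) :=
  ⟨h.bijOn_comp_pullbackCocycle, fun o₁ o₂ =>
    QuadraticCocycles.existsUnique_equiv_of_bijOn (h.bijOn_comp_pullbackCocycle o₁)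
      (h.bijOn_comp_pullbackCocycle o₂)⟩

theorem mainTheorem5 {V : Type*} (K A : PreAbstractSimplicialComplex V) (n : ℕ)
    (hM : QuadraticCocycles.IsTriangulatedManifold K A n) :
    (∀ o : QuadraticCocycles.VertexOrder K,
      Set.BijOn
        (fun Q' : QuadraticCocycles.relCocycles (QuadraticCocycles.sd K)
            (QuadraticCocycles.sdSub K A) ((n : ℤ) - 1) → UnitAddCircle =>
          Q' ∘ QuadraticCocycles.pullbackCocycle
            (QuadraticCocycles.barycentricMap o A) ((n : ℤ) - 1))
        {Q' | QuadraticCocycles.IsQuadratic (QuadraticCocycles.sdOrder K)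
          (QuadraticCocycles.sdSub K A) n Q'}
        {Q | QuadraticCocycles.IsQuadratic o A n Q}) ∧
    (∀ o₁ o₂ : QuadraticCocycles.VertexOrder K,
      ∃! Φ : {Q // QuadraticCocycles.IsQuadratic o₁ A n Q} ≃
          {Q // QuadraticCocycles.IsQuadratic o₂ A n Q},
        ∀ Q' : QuadraticCocycles.relCocycles (QuadraticCocycles.sd K)
            (QuadraticCocycles.sdSub K A) ((n : ℤ) - 1) → UnitAddCircle,
          QuadraticCocycles.IsQuadratic (QuadraticCocycles.sdOrder K)
            (QuadraticCocycles.sdSub K A) n Q' →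
          ∀ Q₁ : {Q // QuadraticCocycles.IsQuadratic o₁ A n Q},
            Q₁.1 = Q' ∘ QuadraticCocycles.pullbackCocycle
              (QuadraticCocycles.barycentricMap o₁ A) ((n : ℤ) - 1) →
            (Φ Q₁).1 = Q' ∘ QuadraticCocycles.pullbackCocycle
              (QuadraticCocycles.barycentricMap o₂ A) ((n : ℤ) - 1)) :=
  mainTheorem5_general K A n hM.isRelativeCycle
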